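/- A tester on $\mathbb{R}^n$ is a randomized algorithm that tosses internal coins, draws finitely many independent samples from an unknown Borel probability distribution $\mathcal{D}$ on $\mathbb{R}^n$, then adaptively queries the values of an unknown function $f\colon\mathbb{R}^n\to\mathbb{R}$ at finitely many points of its choice, and finally accepts or rejects; each query point is a Borel function of the coins, the samples and the previous answers, and the verdict is a Borel function of the coins, the samples and all the answers. By a degree-$d$ polynomial we mean a function $\mathbb{R}^n\to\mathbb{R}$ given by a real polynomial of total degree at most $d$. For $\varepsilon>0$, $f$ is $\varepsilon$-far from degree-$d$ polynomials over $\mathcal{D}$ if $\Pr_{x\sim\mathcal{D}}[f(x)\neq g(x)]>\varepsilon$ for every degree-$d$ polynomial $g$. (If $f$ is not Borel measurable, probabilities of events that involve $f$ are outer probabilities.) **Theorem.** There is an absolute constant $C>0$ such that for all integers $n\ge 0$, $d\geq 1$ and all reals $L>0$, $\varepsilon>0$ there is a tester on $\mathbb{R}^n$, whose number of queries to $f$ plus number of samples from $\mathcal{D}$ is at most $$C\Big(d^5+\frac{d^2}{\varepsilon}\log\frac1\varepsilon\Big),$$ such that for every Borel probability distribution $\mathcal{D}$ on $\mathbb{R}^n$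 and every $f\colon\mathbb{R}^n\to\mathbb{R}$ that is bounded on the ball $B(0,L)$: 1. if $f$ is a degree-$d$ polynomial, then the tester accepts with probability $1$; 2. if $f$ is $\varepsilon$-far from degree-$d$ polynomials over $\mathcal{D}$, then the tester rejects with probability at least $2/3$. The tester depends on $n,d,L,\varepsilon$ only, not on $f$ or $\mathcal{D}$. -/

import Mathlib

open MeasureTheory

noncomputable section

/-- A randomized algorithm with adaptive query access to an unknown function `f : E → ℝ` and sample
access to an unknown distribution on `E`. It tosses its internal coins, draws `numSamples`
independent samples, makes `numQueries` queries to `f`, and then accepts or rejects.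
The point queried in step `i` may depend on the coins, on the samples and on the `i` answers
received so far; the verdict may depend on the coins, the samples and all the answers. None of the
data depends on `f` or on the distribution. The dependence is Borel measurable. -/
structure OracleTester (E : Type) [MeasurableSpace E] where
  /-- The outcomes of the internal coin tosses. -/
  Coins : Type
  [coinsMeasurableSpace : MeasurableSpace Coins]
  [coinsStandardBorel : StandardBorelSpace Coins]
  /-- The law of the internal coin tosses. -/
  coinLaw : Measure Coins
  [coinLawProbability : IsProbabilityMeasure coinLaw]
  /-- The number of samples drawn from the unknown distribution. -/
  numSamples : ℕ
  /-- The number of queries made to the unknown function. -/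
  numQueries : ℕ
  /-- The point queried in step `i = 0, …, numQueries - 1`, given the coins, the samples and the
  answers to the previous `i` queries. (The values for `i ≥ numQueries` are never used.) -/
  query : (i : ℕ) → Coins × (Fin numSamples → E) × (Fin i → ℝ) → E
  measurable_query : ∀ i, Measurable (query i)
  /-- The outcomes (coins, samples, answers) on which the algorithm accepts. -/
  acceptSet : Set (Coins × (Fin numSamples → E) × (Fin numQueries → ℝ))
  measurableSet_acceptSet : MeasurableSet acceptSet

namespace OracleTester

attribute [instance] OracleTester.coinsMeasurableSpace OracleTester.coinsStandardBorel
  OracleTester.coinLawProbability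

variable {E : Type} [MeasurableSpace E]

/-- The answers to the first `i` queries, when the oracle is `f`, the coins are `c` and the samples
are `s`. -/
def answers (T : OracleTester E) (f : E → ℝ) (c : T.Coins) (s : Fin T.numSamples → E) :
    (i : ℕ) → Fin i → ℝ
  | 0 => Fin.elim0
  | i + 1 => Fin.snoc (answers T f c s i) (f (T.query i (c, s, answers T f c s i)))

/-- The algorithm accepts `f`, when the coins are `c` and the samples are `s`. -/
def Accepts (T : OracleTester E) (f : E → ℝ) (c : T.Coins) (s : Fin T.numSamples → E) : Prop :=
  (c, s, T.answers f c s T.numQueries) ∈ T.acceptSet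

/-- The joint law of the coins and of the samples: the samples are independent of each other and of
the coins, and each has law `D`. -/
def runLaw (T : OracleTester E) (D : Measure E) : Measure (T.Coins × (Fin T.numSamples → E)) :=
  T.coinLaw.prod (Measure.pi fun _ => D)

/-- The probability that the algorithm accepts `f` when its samples come from `D`. -/
def acceptProb (T : OracleTester E) (D : Measure E) (f : E → ℝ) : ℝ :=
  (T.runLaw D).real {ω | T.Accepts f ω.1 ω.2}

/-- The probability that the algorithm rejects `f` when its samples come from `D`. (For Borel `f`
this event is Borel; for other `f` this is the outer probability.) -/
def rejectProb (T : OracleTester E) (D : Measure E) (f : E → ℝ) : ℝ :=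
  (T.runLaw D).real {ω | ¬ T.Accepts f ω.1 ω.2}

end OracleTester

/-- The functions `ℝⁿ → ℝ` given by real polynomials in `n` variables of total degree at most
`d`. -/
def polynomialsOfDegreeLE (n d : ℕ) : Set (EuclideanSpace ℝ (Fin n) → ℝ) :=
  {g | ∃ p : MvPolynomial (Fin n) ℝ, p.totalDegree ≤ d ∧
    ∀ x, g x = MvPolynomial.eval (fun i => x i) p}

/-- `f` is `ε`-far from the property `P` over the distribution `D`: it differs from each `g ∈ P` with
probability (outer probability, if that event is not measurable) more than `ε`. -/
def IsFar {E : Type} [MeasurableSpace E] (D : Measure E) (P : Set (E → ℝ)) (ε : ℝ)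
    (f : E → ℝ) : Prop :=
  ∀ g ∈ P, ε < D.real {x | f x ≠ g x}

end

/-! The tester repeats independent rounds of three identities that Lagrange interpolation on lines
gives for every polynomial of degree at most `d`, so completeness is automatic. Wide test: `f x` is
extrapolated from the points `x + s j • a`, where `x` and `a` have law `ρ` and the `s j` are close
to `1`. Narrow test: `f (p + t • q)` is interpolated from equidistant nodes on the segment, where
`p` has law `ρ`, `q` has law `σ` and `t` is uniform. Sample test: `f x` is extrapolated from points
near the origin on the ray through the sample `x`, the value at each of them being itself
extrapolated along a line with random direction `a`.

Soundness is self-correction. The law `ρ` is so spread out that, for bounded `x`, the law of `x + s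
j • a` is at most `4 • ρ`: a slowly decaying density makes the shift harmless, and contractions
close enough to `1` change volumes by at most a factor `2`. If the wide test mostly passes,
extrapolation along random lines through a point `x` of the unit ball therefore has a popular value
`g x` (`exists_measure_lineCombination_ne_le`). Exchanging the rows and columns of a random grid
turns the narrow test for `f` into an exact identity for `g`, for most `t`
(`lineCombination_eq_of_popular`), and rigidity of polynomials removes the exceptional `t`
(`eq_lagrange_of_eq_outside`). So `g` has degree at most `d` on every segment in the unit ball, and
near the origin it is a polynomial `P` of total degree at most `d`
(`exists_mvPolynomial_of_segments`). Wherever `f x ≠ P x`, the sample test fails with probability at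
least `1/2` (`exists_mvPolynomial_measure_ne_le`).

The union bounds involve `d + 1` corrected values, each with error of order `d * η`, so the argument
needs a rejection probability `η` per round of order at most `1 / d ^ 2`. A far function is thus
rejected by a round with probability of order `min (1 / d ^ 2) ε`; about `d ^ 2 + 1 / ε` rounds of
`O(d ^ 2)` queries suffice. -/

open scoped NNReal ENNReal

/-! ### Outer-measure tools: domination of laws, slices, independent repetition -/

section Measures

variable {α β γ δ : Type*} [MeasurableSpace α] [MeasurableSpace β] [MeasurableSpace γ]
  [MeasurableSpace δ]

/-- The set is arbitrary because `f` need not be Borel: for outer measures, a preimage is still no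
larger than the pushforward. -/
lemma measure_preimage_le_of_map_le {μ : Measure α} {ν : Measure β} {T : α → β} {K : ℝ≥0}
    (hT : Measurable T) (h : μ.map T ≤ K • ν) (N : Set β) : μ (T ⁻¹' N) ≤ K * ν N :=
  (Measure.le_map_apply hT.aemeasurable N).trans (h N)

lemma map_prodMap_le {μ₁ : Measure α} {μ₂ : Measure β} {ν₁ : Measure γ} {ν₂ : Measure δ}
    [SFinite μ₁] [SFinite μ₂] [SFinite ν₁] [SFinite ν₂] {T₁ : α → γ} {T₂ : β → δ} {K₁ K₂ : ℝ≥0}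
    (hT₁ : Measurable T₁) (hT₂ : Measurable T₂) (h₁ : μ₁.map T₁ ≤ K₁ • ν₁)
    (h₂ : μ₂.map T₂ ≤ K₂ • ν₂) :
    (μ₁.prod μ₂).map (Prod.map T₁ T₂) ≤ (K₁ * K₂) • (ν₁.prod ν₂) := by
  rw [← Measure.map_prod_map _ _ hT₁ hT₂]
  refine (Measure.prod_mono h₁ h₂).trans (le_of_eq ?_)
  rw [Measure.prod_smul_left, Measure.prod_smul_right, smul_smul]

/-- A set of small outer measure in a product has a slice of small outer measure. -/
lemma exists_measure_slice_le {μ : Measure α} {ν : Measure β} [IsProbabilityMeasure μ] [SFinite ν]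
    {N : Set (α × β)} {δ : ℝ≥0∞} (hN : (μ.prod ν) N ≤ δ) :
    ∃ a, ν (Prod.mk a ⁻¹' N) ≤ δ := by
  -- Tonelli is applied to a measurable hull, which has the same measure and larger slices.
  have hm := measurableSet_toMeasurable (μ.prod ν) N
  obtain ⟨a, ha⟩ := exists_le_lintegral (μ := μ)
    (measurable_measure_prodMk_left (ν := ν) hm).aemeasurable
  refine ⟨a, (measure_mono (Set.preimage_mono (subset_toMeasurable (μ.prod ν) N))).trans
    (ha.trans ?_)⟩
  rwa [← Measure.prod_apply hm, measure_toMeasurable]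

/-- Markov's inequality for the slices of a set, in terms of outer measures. -/
lemma measure_le_slice_mul_le {μ : Measure α} {ν : Measure β} [SFinite ν]
    (N : Set (α × β)) (δ : ℝ≥0∞) :
    δ * μ {a | δ ≤ ν (Prod.mk a ⁻¹' N)} ≤ (μ.prod ν) N := by
  have hm := measurableSet_toMeasurable (μ.prod ν) N
  rw [← measure_toMeasurable N, Measure.prod_apply hm]
  refine le_trans ?_ (mul_meas_ge_le_lintegral₀
    (measurable_measure_prodMk_left (ν := ν) hm).aemeasurable δ)
  gcongr
  exact subset_toMeasurable (μ.prod ν) N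

/-- If all slices over `S` of a map are dominated, so is the map on `S`, for outer measures. -/
lemma measure_prod_preimage_le {μ : Measure α} {ν : Measure β} {ξ : Measure γ}
    [SFinite μ] [IsProbabilityMeasure ν] {F : α → β → γ} {K : ℝ≥0} {S : Set β}
    (hF : Measurable (Function.uncurry F)) (hS : MeasurableSet S)
    (h : ∀ b ∈ S, μ.map (fun a => F a b) ≤ K • ξ) (N : Set γ) :
    (μ.prod ν) {p | p.2 ∈ S ∧ F p.1 p.2 ∈ N} ≤ K * ξ N := by
  have hm := measurableSet_toMeasurable ξ N
  have hM : MeasurableSet {p : α × β | p.2 ∈ S ∧ F p.1 p.2 ∈ toMeasurable ξ N} :=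
    (measurable_snd hS).inter (hF hm)
  refine (measure_mono (t := {p : α × β | p.2 ∈ S ∧ F p.1 p.2 ∈ toMeasurable ξ N})
    fun p hp => ⟨hp.1, subset_toMeasurable _ _ hp.2⟩).trans ?_
  rw [Measure.prod_apply_symm hM, ← measure_toMeasurable N]
  calc _ ≤ ∫⁻ _ : β, K * ξ (toMeasurable ξ N) ∂ν := lintegral_mono fun b => ?_
    _ = _ := by simp
  by_cases hb : b ∈ S
  · refine le_trans (measure_mono ?_) (measure_preimage_le_of_map_le
      (T := fun a => F a b) (hF.comp measurable_prodMk_right) (h b hb) _)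
    exact fun a ha => ha.2
  · have : (fun a => (a, b)) ⁻¹' {p : α × β | p.2 ∈ S ∧ F p.1 p.2 ∈ toMeasurable ξ N} = ∅ := by
      ext a; simp [hb]
    simp [this]

/-- Independent repetition amplifies the outer measure of an event. -/
lemma one_sub_pow_le_measure_pi {μ : Measure α} [IsProbabilityMeasure μ] {N : Set α} {η : ℝ≥0∞}
    (hη : η ≤ μ N) (m : ℕ) :
    1 - (1 - η) ^ m ≤ (Measure.pi fun _ : Fin m => μ) {ω | ∃ i, ω i ∈ N} := by
  induction m with
  | zero => simp
  | succ m ih =>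
    have hη1 : η ≤ 1 := hη.trans prob_le_one
    have e := measurePreserving_piFinSuccAbove (fun _ : Fin (m + 1) => μ) 0
    set P := Measure.pi fun _ : Fin m => μ
    have h1 : (Measure.pi fun _ : Fin (m + 1) => μ) {ω | ∃ i, ω i ∈ N} =
        (μ.prod P) {p | p.1 ∈ N ∨ ∃ i, p.2 i ∈ N} := by
      rw [← e.measure_preimage_equiv]
      congr 1
      ext ω
      simp [Fin.exists_fin_succ, Fin.tail]
    rw [h1]
    set B : Set (α × (Fin m → α)) := {p | p.1 ∈ N ∨ ∃ i, p.2 i ∈ N}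
    have hm := measurableSet_toMeasurable (μ.prod P) B
    rw [← measure_toMeasurable B, Measure.prod_apply hm]
    set s : α → ℝ≥0∞ := fun a => P (Prod.mk a ⁻¹' toMeasurable (μ.prod P) B)
    have hs : Measurable s := measurable_measure_prodMk_left hm
    have hsub : ∀ a, Prod.mk a ⁻¹' B ⊆ Prod.mk a ⁻¹' toMeasurable (μ.prod P) B := fun a =>
      Set.preimage_mono (subset_toMeasurable (μ.prod P) B)
    have hs1 : ∀ a, 1 - (1 - η) ^ m ≤ s a := fun a =>
      ih.trans (measure_mono (Set.Subset.trans (fun ω hω => Or.inr hω) (hsub a)))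
    -- `N` need not be measurable; it is replaced by the measurable set of full slices, which
    -- contains it.
    have hsN : N ⊆ {a | 1 ≤ s a} := fun a ha => by
      have : Prod.mk a ⁻¹' B = Set.univ := by ext ω; simp [B, ha]
      calc (1 : ℝ≥0∞) = P (Prod.mk a ⁻¹' B) := by rw [this, measure_univ]
        _ ≤ s a := measure_mono (hsub a)
    have hT : MeasurableSet {a | 1 ≤ s a} := measurableSet_le measurable_const hs
    have hle : η ≤ μ {a | 1 ≤ s a} := hη.trans (measure_mono hsN)
    have hpt : ∀ a, (1 - (1 - η) ^ m) + {a | 1 ≤ s a}.indicator (fun _ => (1 - η) ^ m) a ≤ s a := by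
      intro a
      by_cases ha : 1 ≤ s a
      · rw [Set.indicator_of_mem (by exact ha), tsub_add_cancel_of_le]
        · exact ha
        · exact pow_le_one' tsub_le_self m
      · rw [Set.indicator_of_notMem (by exact ha), add_zero]
        exact hs1 a
    refine le_trans ?_ (lintegral_mono hpt)
    rw [lintegral_add_left measurable_const, lintegral_indicator_const hT]
    simp only [lintegral_const, measure_univ, mul_one]
    refine le_trans ?_ (add_le_add_right (mul_le_mul_right hle _) _)
    rw [tsub_le_iff_right]
    have hp : (1 - η) ^ m ≤ 1 := pow_le_one' tsub_le_self m
    calc (1 : ℝ≥0∞) = 1 - (1 - η) ^ m + (1 - η) ^ m * (η + (1 - η)) := by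
          rw [add_tsub_cancel_of_le hη1, mul_one, tsub_add_cancel_of_le hp]
      _ ≤ _ := by rw [mul_add, ← pow_succ, add_assoc]

end Measures

/-! ### Laws almost invariant under bounded translations and slight contractions -/

section Spread

variable {V : Type*} [NormedAddCommGroup V] [NormedSpace ℝ V] [FiniteDimensional ℝ V]
  [MeasurableSpace V] [BorelSpace V]

lemma half_le_pow_of_one_sub_le {k : ℕ} {s : ℝ} (hs : 1 - 1 / (2 * ((k : ℝ) + 1)) ≤ s) :
    1 / 2 ≤ s ^ k := by
  have hk : (0 : ℝ) < 2 * ((k : ℝ) + 1) := by positivity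
  have h1 : 1 / (2 * ((k : ℝ) + 1)) ≤ 1 / 2 := by
    gcongr
    linarith [(Nat.cast_nonneg k : (0 : ℝ) ≤ k)]
  have h2 := one_add_mul_le_pow (a := -(1 / (2 * ((k : ℝ) + 1)))) (by linarith) k
  have h3 : (k : ℝ) * (1 / (2 * ((k : ℝ) + 1))) ≤ 1 / 2 := by
    rw [mul_one_div, div_le_div_iff₀ hk (by norm_num)]
    linarith
  calc (1 : ℝ) / 2 ≤ (1 + -(1 / (2 * ((k : ℝ) + 1)))) ^ k := by linarith
    _ ≤ s ^ k := pow_le_pow_left₀ (by linarith) (by linarith) k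

/-- The pushforward is `s ^ (-k) • μ` with `k` the dimension, and Bernoulli's inequality gives `s ^
k ≥ 1/2`. -/
lemma map_affine_addHaar_le (μ : Measure V) [μ.IsAddHaarMeasure] (x : V) {s : ℝ}
    (hs : 1 - 1 / (2 * ((Module.finrank ℝ V : ℝ) + 1)) ≤ s) :
    μ.map (fun a => x + s • a) ≤ (2 : ℝ≥0) • μ := by
  have hpow := half_le_pow_of_one_sub_le hs
  have hs0 : s ≠ 0 := by
    rintro rfl
    have : 1 / (2 * ((Module.finrank ℝ V : ℝ) + 1)) ≤ 1 / 2 := by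
      gcongr
      linarith [(Nat.cast_nonneg (Module.finrank ℝ V) : (0 : ℝ) ≤ Module.finrank ℝ V)]
    linarith
  have : μ.map (fun a => x + s • a) = (μ.map (s • ·)).map (x + ·) := by
    rw [Measure.map_map (measurable_const_add x) (measurable_const_smul s)]
    rfl
  rw [this, Measure.map_addHaar_smul μ hs0, Measure.map_smul, map_add_left_eq_self]
  intro A
  simp only [Measure.smul_apply, smul_eq_mul, ENNReal.smul_def]
  gcongr
  refine ENNReal.ofReal_le_of_le_toReal ?_
  rw [abs_of_nonneg (by positivity)]
  simpa using inv_anti₀ (by norm_num) hpow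

/-- There are probability measures that no translation by a bounded vector, combined with a slight
contraction, increases by more than a constant factor. -/
lemma exists_isProbabilityMeasure_map_affine_le {B : ℝ} (hB : 0 ≤ B) :
    ∃ ρ : Measure V, IsProbabilityMeasure ρ ∧ ∀ (x : V) (s : ℝ), ‖x‖ ≤ B →
      1 - 1 / (2 * ((Module.finrank ℝ V : ℝ) + 1)) ≤ s → s ≤ 1 →
        ρ.map (fun a => x + s • a) ≤ (4 : ℝ≥0) • ρ := by
  set k := Module.finrank ℝ V
  set r : ℕ := k + 1 with hr
  set μ : Measure V := Measure.addHaar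
  -- The density will be proportional to `(1 + S * ‖y‖) ^ (-r)`: the exponent `r = k + 1` makes it
  -- integrable, and a small scale `S` makes a shift by `B` cost a factor at most `(1 + S * B) ^ r ≤
  -- exp (1/2) ≤ 2`.
  obtain ⟨S, hS0, hS⟩ : ∃ S : ℝ, 0 < S ∧ (1 + S * B) ^ r ≤ 2 := by
    refine ⟨1 / (2 * r * (B + 1)), by positivity, ?_⟩
    calc (1 + 1 / (2 * r * (B + 1)) * B) ^ r ≤ (Real.exp (1 / (2 * r))) ^ r := by
          have h : 1 / (2 * r * (B + 1)) * B ≤ 1 / (2 * r) := by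
            rw [one_div_mul_eq_div, div_le_div_iff₀ (by positivity) (by positivity)]
            nlinarith [(Nat.cast_nonneg r : (0 : ℝ) ≤ r)]
          gcongr
          linarith [Real.add_one_le_exp (1 / (2 * (r : ℝ)))]
      _ = Real.exp (1 / 2) := by
          have hr0 : (r : ℝ) ≠ 0 := by simp [hr]; positivity
          rw [← Real.exp_nat_mul]
          congr 1
          field_simp
      _ ≤ 2 := by
          rw [← Real.le_log_iff_exp_le (by norm_num)]
          linarith [Real.log_two_gt_d9]
  set h : V → ℝ := fun y => ((1 + S * ‖y‖) ^ r)⁻¹ with hh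
  have hpos : ∀ y : V, 0 < 1 + S * ‖y‖ := fun y => by positivity
  have hcont : Continuous h := by
    refine Continuous.inv₀ (by fun_prop) fun y => (pow_pos (hpos y) r).ne'
  have hint : Integrable h μ := by
    have h1 := (integrable_one_add_norm (E := V) (μ := μ) (r := (r : ℝ))
      (by simp [hr, k])).comp_smul hS0.ne'
    refine h1.congr (Filter.Eventually.of_forall fun y => ?_)
    simp only [hh, norm_smul, Real.norm_eq_abs, abs_of_pos hS0]
    rw [Real.rpow_neg (hpos y).le, Real.rpow_natCast]
  set H : V → ℝ≥0∞ := fun y => ENNReal.ofReal (h y)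
  have hHm : Measurable H := hcont.measurable.ennreal_ofReal
  have hdens : ∀ (x : V) (s : ℝ), ‖x‖ ≤ B → 0 ≤ s → s ≤ 1 → ∀ a, H a ≤ 2 * H (x + s • a) := by
    intro x s hx hs0 hs1 a
    have h2 : (2 : ℝ≥0∞) = ENNReal.ofReal 2 := by simp
    rw [h2, ← ENNReal.ofReal_mul (by norm_num)]
    refine ENNReal.ofReal_le_ofReal ?_
    simp only [hh]
    rw [← div_eq_mul_inv, inv_eq_one_div,
      div_le_div_iff₀ (pow_pos (hpos _) r) (pow_pos (hpos _) r), one_mul]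
    have hn : ‖x + s • a‖ ≤ B + ‖a‖ := by
      refine (norm_add_le _ _).trans (add_le_add hx ?_)
      rw [norm_smul, Real.norm_eq_abs, abs_of_nonneg hs0]
      exact mul_le_of_le_one_left (norm_nonneg a) hs1
    calc (1 + S * ‖x + s • a‖) ^ r ≤ ((1 + S * B) * (1 + S * ‖a‖)) ^ r := by
          refine pow_le_pow_left₀ (hpos _).le ?_ r
          nlinarith [mul_le_mul_of_nonneg_left hn hS0.le,
            mul_nonneg (mul_nonneg hS0.le hB) (mul_nonneg hS0.le (norm_nonneg a))]
      _ = (1 + S * B) ^ r * (1 + S * ‖a‖) ^ r := mul_pow _ _ _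
      _ ≤ _ := by gcongr
  set μ₀ := μ.withDensity H
  have hfin : IsFiniteMeasure μ₀ := isFiniteMeasure_withDensity_ofReal hint.2
  have hne : μ₀ Set.univ ≠ 0 := by
    rw [withDensity_apply _ MeasurableSet.univ, Measure.restrict_univ, ne_eq,
      lintegral_eq_zero_iff hHm]
    intro h0
    have hf : ∀ᵐ _ : V ∂μ, False := h0.mono fun y hy => by
      have : 0 < h y := inv_pos.2 (pow_pos (hpos y) r)
      simp [H, not_le.2 this] at hy
    simp at hf
    exact NeZero.ne μ hf
  -- The factor `4` is `2` from the density times `2` from the change of volume.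
  have hmap : ∀ (x : V) (s : ℝ), ‖x‖ ≤ B → 1 - 1 / (2 * ((k : ℝ) + 1)) ≤ s → s ≤ 1 →
      μ₀.map (fun a => x + s • a) ≤ (4 : ℝ≥0) • μ₀ := by
    intro x s hx hs hs1
    have hT : Measurable fun a : V => x + s • a := by fun_prop
    have hs0 : 0 ≤ s := by
      have : 1 / (2 * ((k : ℝ) + 1)) ≤ 1 := by
        rw [div_le_one (by positivity)]
        linarith [(Nat.cast_nonneg k : (0 : ℝ) ≤ k)]
      linarith
    refine Measure.le_iff.2 fun A hA => ?_
    rw [Measure.map_apply hT hA, withDensity_apply _ (hT hA), ← lintegral_indicator (hT hA)]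
    calc ∫⁻ a, ((fun a => x + s • a) ⁻¹' A).indicator H a ∂μ
        ≤ ∫⁻ a, (A.indicator fun y => 2 * H y) (x + s • a) ∂μ := by
          refine lintegral_mono fun a => ?_
          by_cases ha : x + s • a ∈ A
          · rw [Set.indicator_of_mem (by exact ha), Set.indicator_of_mem ha]
            exact hdens x s hx hs0 hs1 a
          · rw [Set.indicator_of_notMem (by exact ha)]
            exact zero_le
      _ = ∫⁻ y, (A.indicator fun y => 2 * H y) y ∂(μ.map fun a => x + s • a) := by
          rw [lintegral_map ((hHm.const_mul 2).indicator hA) hT]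
      _ ≤ ∫⁻ y, (A.indicator fun y => 2 * H y) y ∂((2 : ℝ≥0) • μ) :=
          lintegral_mono' (map_affine_addHaar_le μ x hs) le_rfl
      _ = ((4 : ℝ≥0) • μ₀) A := by
          rw [lintegral_smul_measure, lintegral_indicator hA, lintegral_const_mul _ hHm,
            Measure.smul_apply, withDensity_apply _ hA]
          simp only [ENNReal.smul_def, smul_eq_mul, ← mul_assoc]
          norm_num
  refine ⟨(μ₀ Set.univ)⁻¹ • μ₀, ⟨?_⟩, fun x s hx hs hs1 => ?_⟩
  · rw [Measure.smul_apply, smul_eq_mul, ENNReal.inv_mul_cancel hne (measure_ne_top _ _)]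
  · rw [Measure.map_smul, smul_comm]
    intro A
    simp only [Measure.smul_apply]
    have := hmap x s hx hs hs1 A
    simp only [Measure.smul_apply] at this
    exact mul_le_mul_right this _

end Spread

/-- The mass of a finite measure concentrates on balls. -/
lemma exists_measure_norm_gt_le {V : Type*} [NormedAddCommGroup V] [MeasurableSpace V]
    [BorelSpace V] (μ : Measure V) [IsFiniteMeasure μ] {δ : ℝ≥0∞} (hδ : 0 < δ) :
    ∃ R : ℝ, 0 ≤ R ∧ μ {b | R < ‖b‖} ≤ δ := by
  have hlim := tendsto_measure_iInter_atTop (μ := μ) (s := fun m : ℕ => {b : V | (m : ℝ) < ‖b‖})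
    (fun m => (measurableSet_lt measurable_const measurable_norm).nullMeasurableSet)
    (fun i j hij b hb => lt_of_le_of_lt (Nat.cast_le.2 hij : (i : ℝ) ≤ j) hb) ⟨0, measure_ne_top _ _⟩
  have : (⋂ m : ℕ, {b : V | (m : ℝ) < ‖b‖}) = ∅ := by
    refine Set.eq_empty_of_forall_notMem fun b hb => ?_
    obtain ⟨m, hm⟩ := exists_nat_ge ‖b‖
    exact absurd (Set.mem_iInter.1 hb m) (not_lt.2 hm)
  rw [this, measure_empty] at hlim
  obtain ⟨m, hm⟩ := (hlim.eventually_le_const hδ).exists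
  exact ⟨m, Nat.cast_nonneg m, hm⟩

/-! ### Self-correction along random lines -/

noncomputable section

/-- The coefficient of the value at `ν k` in the interpolation formula for the value at `t` of a
polynomial of degree at most `d`, from its values at the nodes `ν`. -/
def lagrangeWeight {d : ℕ} (ν : Fin (d + 1) → ℝ) (k : Fin (d + 1)) (t : ℝ) : ℝ :=
  (Lagrange.basis Finset.univ ν k).eval t

/-- The combination with coefficients `w` of the values of `f` at the points `x + s j • a`. -/
def lineCombination {ι V : Type*} [Fintype ι] [AddCommGroup V] [Module ℝ V] (s w : ι → ℝ)
    (f : V → ℝ) (x a : V) : ℝ :=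
  ∑ j, w j * f (x + s j • a)

section Correction

variable {V ι κ : Type*} [Fintype ι] [Fintype κ] [NormedAddCommGroup V] [NormedSpace ℝ V]
  [MeasurableSpace V] [BorelSpace V] [SecondCountableTopology V]

/-- If most values of `f` are given by a fixed combination of values along a random line, then this
combination has a most popular value along the random lines through a given point. -/
lemma exists_measure_lineCombination_ne_le {ρ : Measure V} [IsProbabilityMeasure ρ] {s w : ι → ℝ}
    {f : V → ℝ} {x : V} {K : ℝ≥0} {η : ℝ≥0∞}
    (hρ : ∀ j, ρ.map (fun a => x + s j • a) ≤ K • ρ)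
    (hη : (ρ.prod ρ) {p | f p.1 ≠ lineCombination s w f p.1 p.2} ≤ η) :
    ∃ y, ρ {a | lineCombination s w f x a ≠ y} ≤ 2 * (Fintype.card ι * (K * η)) := by
  set N := {p : V × V | f p.1 ≠ lineCombination s w f p.1 p.2}
  set T : ι → V × V → V × V := fun j => Prod.map (fun a => x + s j • a) id
  have haff : ∀ j, Measurable fun a : V => x + s j • a := fun j => by fun_prop
  have hT : ∀ j, (ρ.prod ρ) (T j ⁻¹' N) ≤ K * η := fun j => by
    have h := map_prodMap_le (μ₂ := ρ) (ν₂ := ρ) (haff j) measurable_id (hρ j)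
      (K₂ := 1) (by simp)
    rw [mul_one] at h
    exact (measure_preimage_le_of_map_le ((haff j).prodMap measurable_id) h N).trans (by gcongr)
  have hS : ∀ j, (ρ.prod ρ) (Prod.swap ⁻¹' (T j ⁻¹' N)) ≤ K * η := fun j => by
    refine (Measure.le_map_apply measurable_swap.aemeasurable _).trans ?_
    rw [Measure.prod_swap]
    exact hT j
  -- For two random directions, both combinations equal the same double sum over `x + s i • a + s j
  -- • b` unless `f` fails the relation at one of the points `x + s j • a` or `x + s j • b`. This
  -- costs two union bounds over `ι`; fixing one direction `b` yields the popular value.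
  obtain ⟨b, hb⟩ := exists_measure_slice_le (μ := ρ) (ν := ρ)
    (N := {p | lineCombination s w f x p.2 ≠ lineCombination s w f x p.1})
    (δ := 2 * (Fintype.card ι * (K * η))) (by
      refine (measure_mono (t := (⋃ j, T j ⁻¹' N) ∪ ⋃ j, Prod.swap ⁻¹' (T j ⁻¹' N))
        fun p hp => ?_).trans ((measure_union_le _ _).trans ?_)
      · by_contra hcon
        simp only [Set.mem_union, Set.mem_iUnion, Set.mem_preimage, N, T, Set.mem_ofPred_eq,
          Prod.map_fst, Prod.map_snd, Prod.fst_swap, Prod.snd_swap, id, not_or, not_exists,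
          not_not] at hcon
        obtain ⟨h1, h2⟩ := hcon
        refine hp ?_
        simp only [lineCombination] at h1 h2 ⊢
        simp_rw [h1, h2, Finset.mul_sum]
        rw [Finset.sum_comm]
        refine Finset.sum_congr rfl fun i _ => Finset.sum_congr rfl fun j _ => ?_
        rw [show x + s j • p.2 + s i • p.1 = x + s i • p.1 + s j • p.2 by abel]
        ring
      · rw [two_mul]
        refine add_le_add ?_ ?_ <;>
        · refine (measure_iUnion_fintype_le _ _).trans
            ((Finset.sum_le_sum (g := fun _ => K * η) fun j _ => ?_).trans (le_of_eq (by simp)))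
          first | exact hT j | exact hS j)
  exact ⟨lineCombination s w f x b, hb⟩

/-- The most popular values satisfy the linear relation along lines that `f` satisfies along most
random lines. -/
lemma lineCombination_eq_of_popular {ρ σ : Measure V} [IsProbabilityMeasure ρ]
    [IsProbabilityMeasure σ] {s w : ι → ℝ} {ν c : κ → ℝ} {f g : V → ℝ} {R t : ℝ} {δ θ : ℝ≥0∞}
    (hρ : ∀ (x : V), ‖x‖ ≤ R + 1 → ∀ j, ρ.map (fun a => x + s j • a) ≤ (4 : ℝ≥0) • ρ)
    (hρ' : ∀ (x : V), ‖x‖ ≤ R → ρ.map (fun a => x + a) ≤ (4 : ℝ≥0) • ρ)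
    (hσ : ∀ (x : V), ‖x‖ ≤ 2 → ∀ j, σ.map (fun a => x + s j • a) ≤ (4 : ℝ≥0) • σ)
    (hR : 0 ≤ R) (hσR : σ {b | R < ‖b‖} ≤ 1 / 8)
    (hg : ∀ x, ‖x‖ ≤ 1 → ρ {a | lineCombination s w f x a ≠ g x} ≤ δ)
    (ht : t ∈ Set.Icc (0 : ℝ) 1) (hν : ∀ k, ν k ∈ Set.Icc (0 : ℝ) 1)
    (hθ : (ρ.prod σ) {p | f (p.1 + t • p.2) ≠ lineCombination ν c f p.1 p.2} ≤ θ)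
    (hsmall : 1 / 8 + ((Fintype.card κ + 1) * (4 * δ) + Fintype.card ι * (16 * θ)) < 1)
    {p q : V} (hp : ‖p‖ ≤ 1) (hpq : ‖p + q‖ ≤ 1) :
    g (p + t • q) = lineCombination ν c g p q := by
  have hq : ‖q‖ ≤ 2 := by
    calc ‖q‖ = ‖(p + q) - p‖ := by simp
      _ ≤ ‖p + q‖ + ‖p‖ := norm_sub_le _ _
      _ ≤ 2 := by linarith
  have hseg : ∀ τ ∈ Set.Icc (0 : ℝ) 1, ‖p + τ • q‖ ≤ 1 := fun τ hτ => by
    calc ‖p + τ • q‖ = ‖(1 - τ) • p + τ • (p + q)‖ := by congr 1; module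
      _ ≤ (1 - τ) * ‖p‖ + τ * ‖p + q‖ := by
          refine (norm_add_le _ _).trans (le_of_eq ?_)
          rw [norm_smul, norm_smul, Real.norm_eq_abs, Real.norm_eq_abs, abs_of_nonneg hτ.1,
            abs_of_nonneg (sub_nonneg.2 hτ.2)]
      _ ≤ 1 := by nlinarith [hτ.1, hτ.2]
  set M := {p : V × V | f (p.1 + t • p.2) ≠ lineCombination ν c f p.1 p.2}
  set S : Set V := {b | ‖b‖ ≤ R}
  have hS : MeasurableSet S := measurableSet_le measurable_norm measurable_const
  -- Consider the grid of points `p + τ • q + s j • (a + τ • b)`. The set `U τ` is where a row fails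
  -- to return `g (p + τ • q)`; its direction `a + τ • b` has law dominated by `4 • ρ` as long as
  -- `‖b‖ ≤ R`.
  set U : ℝ → Set (V × V) := fun τ =>
    {z | z.2 ∈ S ∧ z.1 + τ • z.2 ∈ {a | lineCombination s w f (p + τ • q) a ≠ g (p + τ • q)}}
  have hU : ∀ τ ∈ Set.Icc (0 : ℝ) 1, (ρ.prod σ) (U τ) ≤ 4 * δ := fun τ hτ => by
    refine (measure_prod_preimage_le (F := fun a b => a + τ • b) (K := 4) (ξ := ρ) (by fun_prop) hS
      (fun b hb => ?_) _).trans ?_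
    · simp_rw [add_comm _ (τ • b)]
      refine hρ' _ ?_
      rw [norm_smul, Real.norm_eq_abs, abs_of_nonneg hτ.1]
      exact (mul_le_of_le_one_left (norm_nonneg _) hτ.2).trans hb
    · exact mul_le_mul_right (hg _ (hseg τ hτ)) _
  -- The set `W j` is where `f` fails the narrow relation on the column with base `p + s j • a` and
  -- direction `q + s j • b`. The factor `16` is `4` for each of the two.
  set W : ι → Set (V × V) := fun j =>
    Prod.map (fun a => p + s j • a) (fun b => q + s j • b) ⁻¹' M
  have hW : ∀ j, (ρ.prod σ) (W j) ≤ 16 * θ := fun j => by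
    have h1 : ∀ y : V, Measurable fun a : V => y + s j • a := fun y => by fun_prop
    have h := map_prodMap_le (h1 p) (h1 q) (hρ p (by linarith) j) (hσ q hq j)
    refine (measure_preimage_le_of_map_le ((h1 p).prodMap (h1 q)) h M).trans ?_
    norm_num
    gcongr
  have htail : (ρ.prod σ) {z | R < ‖z.2‖} ≤ 1 / 8 := by
    have : {z : V × V | R < ‖z.2‖} = Set.univ ×ˢ {b | R < ‖b‖} := by ext; simp
    rw [this, Measure.prod_prod, measure_univ, one_mul]
    exact hσR
  set B := {z : V × V | R < ‖z.2‖} ∪ (((⋃ k, U (ν k)) ∪ U t) ∪ ⋃ j, W j)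
  have hB : (ρ.prod σ) B < 1 := by
    refine lt_of_le_of_lt ?_ hsmall
    refine (measure_union_le _ _).trans (add_le_add htail ((measure_union_le _ _).trans
      (add_le_add ((measure_union_le _ _).trans ?_) ?_)))
    · rw [add_mul, one_mul]
      refine add_le_add ?_ (hU t ht)
      refine (measure_iUnion_fintype_le _ _).trans
        ((Finset.sum_le_sum fun k _ => hU _ (hν k)).trans (le_of_eq (by simp)))
    · refine (measure_iUnion_fintype_le _ _).trans
        ((Finset.sum_le_sum fun j _ => hW j).trans (le_of_eq (by simp)))
  -- The claim does not involve `a` and `b`, so a single good pair proves it, by exchanging the sums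
  -- over rows and columns.
  obtain ⟨⟨a, b⟩, hab⟩ : ∃ z, z ∉ B := by
    by_contra! hcon
    rw [Set.eq_univ_of_forall hcon, measure_univ] at hB
    exact lt_irrefl _ hB
  simp only [B, U, W, M, S, Set.mem_union, Set.mem_iUnion, Set.mem_ofPred_eq, Set.mem_preimage,
    Prod.map_apply, not_or, not_exists, not_lt, not_and, not_not] at hab
  obtain ⟨hb, ⟨hk, hgt⟩, hj⟩ := hab
  rw [← hgt hb]
  unfold lineCombination
  simp_rw [fun k => (hk k hb).symm]
  unfold lineCombination at hj ⊢
  simp_rw [Finset.mul_sum]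
  rw [Finset.sum_comm]
  refine Finset.sum_congr rfl fun j _ => ?_
  have e : ∀ τ : ℝ, p + τ • q + s j • (a + τ • b) = p + s j • a + τ • (q + s j • b) := fun τ => by
    module
  rw [e, hj, Finset.mul_sum]
  refine Finset.sum_congr rfl fun k _ => ?_
  rw [e]
  ring

end Correction

/-- A function on `[0, 1]` that agrees with its interpolation polynomial on most of each segment is
a polynomial. -/
lemma eq_lagrange_of_eq_outside {d : ℕ} {ν : Fin (d + 1) → ℝ} (hinj : Function.Injective ν)
    (h0 : ν 0 = 0) {φ : ℝ → ℝ} {Z : Set ℝ} (hZ : volume (Z ∩ Set.Icc 0 1) ≤ 1 / 10)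
    (hφ : ∀ x ∈ Set.Icc (0 : ℝ) 1, ∀ y ∈ Set.Icc (0 : ℝ) 1, ∀ t ∈ Set.Icc (0 : ℝ) 1, t ∉ Z →
      φ (x + t * (y - x)) = ∑ k, lagrangeWeight ν k t * φ (x + ν k * (y - x)))
    {τ : ℝ} (hτ : τ ∈ Set.Icc (0 : ℝ) 1) :
    φ τ = ∑ k, lagrangeWeight ν k τ * φ (ν k) := by
  -- The interpolants of `φ` on `[0, 1]` and on the segment from `τ` to `c` are compared. As `c` is
  -- at distance at least `1/2`, rescaling at most doubles the measure of the exceptional set, so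
  -- they agree at infinitely many parameters.
  obtain ⟨c, hc, hcτ⟩ : ∃ c ∈ Set.Icc (0 : ℝ) 1, 1 / 2 ≤ |c - τ| := by
    rcases le_total τ (1 / 2) with h | h
    · exact ⟨1, by simp, by rw [le_abs]; left; linarith⟩
    · exact ⟨0, by simp, by rw [le_abs]; right; linarith⟩
  have hm : c - τ ≠ 0 := fun h => by rw [h] at hcτ; norm_num at hcτ
  set P₁ : Polynomial ℝ := ∑ k, Polynomial.C (φ (ν k)) * Lagrange.basis Finset.univ ν k
  set P₂ : Polynomial ℝ :=
    ∑ k, Polynomial.C (φ (τ + ν k * (c - τ))) * Lagrange.basis Finset.univ ν k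
  have hP₁ : ∀ t, P₁.eval t = ∑ k, lagrangeWeight ν k t * φ (ν k) := fun t => by
    simp [P₁, Polynomial.eval_finsetSum, lagrangeWeight, mul_comm]
  have hP₂ : ∀ t, P₂.eval t = ∑ k, lagrangeWeight ν k t * φ (τ + ν k * (c - τ)) := fun t => by
    simp [P₂, Polynomial.eval_finsetSum, lagrangeWeight, mul_comm]
  set Z' := (fun s => τ + (c - τ) * s) ⁻¹' (Z ∩ Set.Icc 0 1)
  have hZ' : volume Z' ≤ 2 / 10 := by
    have : Z' = ((c - τ) * ·) ⁻¹' ((τ + ·) ⁻¹' (Z ∩ Set.Icc 0 1)) := rfl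
    rw [this, Real.volume_preimage_mul_left hm, measure_preimage_add]
    calc _ ≤ 2 * (1 / 10 : ℝ≥0∞) := by
          gcongr
          refine ENNReal.ofReal_le_of_le_toReal ?_
          rw [abs_inv, ENNReal.toReal_ofNat]
          simpa using inv_anti₀ (by norm_num) hcτ
      _ = _ := by rw [← mul_div_assoc, mul_one]
  set A := {s | s ∈ Set.Icc (0 : ℝ) 1 ∧ s ∉ Z ∧ s ∉ Z'}
  have hA : A.Infinite := by
    intro hfin
    have h1 : Set.Icc (0 : ℝ) 1 ⊆ A ∪ ((Z ∩ Set.Icc 0 1) ∪ Z') := fun s hs => by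
      by_cases h1 : s ∈ Z
      · exact Or.inr (Or.inl ⟨h1, hs⟩)
      · by_cases h2 : s ∈ Z'
        · exact Or.inr (Or.inr h2)
        · exact Or.inl ⟨hs, h1, h2⟩
    have h2 : volume (Set.Icc (0 : ℝ) 1) ≤ 0 + (1 / 10 + 2 / 10) :=
      (measure_mono h1).trans ((measure_union_le _ _).trans (add_le_add
        (hfin.measure_zero volume).le ((measure_union_le _ _).trans (add_le_add hZ hZ'))))
    rw [Real.volume_Icc, zero_add, ENNReal.div_add_div_same] at h2
    norm_num at h2
    rw [← ENNReal.toReal_le_toReal (by simp) (by finiteness)] at h2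
    norm_num at h2
  have hcomp : P₁.comp (Polynomial.C τ + Polynomial.C (c - τ) * Polynomial.X) = P₂ := by
    refine Polynomial.eq_of_infinite_eval_eq _ _ (hA.mono fun s hs => ?_)
    obtain ⟨hs, hsZ, hsZ'⟩ := hs
    have hmem : τ + (c - τ) * s ∈ Set.Icc (0 : ℝ) 1 := by
      constructor <;> nlinarith [hs.1, hs.2, hc.1, hc.2, hτ.1, hτ.2]
    have e1 := hφ 0 (by simp) 1 (by simp) (τ + (c - τ) * s) hmem fun h => hsZ' ⟨h, hmem⟩
    have e2 := hφ τ hτ c hc s hs hsZ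
    simp only [zero_add, sub_zero, mul_one] at e1
    simp only [Set.mem_ofPred_eq, Polynomial.eval_comp, Polynomial.eval_add, Polynomial.eval_C,
      Polynomial.eval_mul, Polynomial.eval_X]
    rw [hP₁, hP₂, ← e1, ← e2, mul_comm s]
  -- Since `0` is a node, the second interpolant takes the value `φ τ` at `0`, even if `τ ∈ Z`.
  have h := congrArg (Polynomial.eval 0) hcomp
  simp only [Polynomial.eval_comp, Polynomial.eval_add, Polynomial.eval_C, Polynomial.eval_mul,
    Polynomial.eval_X, mul_zero, add_zero] at h
  rw [hP₁, hP₂] at h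
  rw [h, Finset.sum_eq_single 0]
  · have : lagrangeWeight ν 0 0 = 1 := by
      unfold lagrangeWeight
      rw [← h0, Lagrange.eval_basis_self hinj.injOn (Finset.mem_univ _)]
    simp [this, h0]
  · intro k _ hk
    have : lagrangeWeight ν k 0 = 0 := by
      unfold lagrangeWeight
      have h := Lagrange.eval_basis_of_ne (v := ν) hk (Finset.mem_univ 0)
      rwa [h0] at h
    rw [this, zero_mul]
  · simp

end

/-! ### From polynomials on segments to polynomials in several variables -/

section Polynomials

lemma sum_lagrangeWeight_mul_eval {d : ℕ} {ν : Fin (d + 1) → ℝ} (hν : Function.Injective ν)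
    {q : Polynomial ℝ} (hq : q.natDegree ≤ d) (t : ℝ) :
    q.eval t = ∑ k, lagrangeWeight ν k t * q.eval (ν k) := by
  have hdeg : q.degree < (Finset.univ : Finset (Fin (d + 1))).card := by
    rw [Finset.card_univ, Fintype.card_fin]
    exact Polynomial.degree_lt_iff_coeff_zero _ _ |>.2 fun m hm =>
      Polynomial.coeff_eq_zero_of_natDegree_lt (by omega)
  conv_lhs => rw [Lagrange.eq_interpolate (s := Finset.univ) hν.injOn hdeg]
  simp [Lagrange.interpolate_apply, Polynomial.eval_finsetSum, lagrangeWeight, mul_comm]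

/-- Lagrange interpolation along a line. -/
lemma MvPolynomial.eval_line_eq_sum {σ : Type*} {d : ℕ} {ν : Fin (d + 1) → ℝ}
    (hν : Function.Injective ν) {p : MvPolynomial σ ℝ} (hp : p.totalDegree ≤ d) (a b : σ → ℝ)
    (t : ℝ) :
    MvPolynomial.eval (fun i => a i + t * b i) p =
      ∑ k, lagrangeWeight ν k t * MvPolynomial.eval (fun i => a i + ν k * b i) p := by
  set f : σ → Polynomial ℝ := fun i => Polynomial.C (b i) * Polynomial.X + Polynomial.C (a i)
  have hdeg : (MvPolynomial.aeval f p).natDegree ≤ d := by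
    simpa using MvPolynomial.aeval_natDegree_le p hp f fun i => Polynomial.natDegree_linear_le
  have heval : ∀ s : ℝ, (MvPolynomial.aeval f p).eval s =
      MvPolynomial.eval (fun i => a i + s * b i) p := fun s => by
    rw [← Polynomial.coe_aeval_eq_eval, ← AlgHom.comp_apply,
      MvPolynomial.comp_aeval, ← MvPolynomial.coe_aeval_eq_eval, RingHom.coe_coe]
    congr 2
    funext i
    simp [f]
    ring
  simp_rw [← heval]
  exact sum_lagrangeWeight_mul_eval hν hdeg t

/-- A function on a cube that is a polynomial in each variable is a polynomial. -/
lemma exists_mvPolynomial_of_separately {κ : Type*} [Fintype κ] (z : κ → ℝ)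
    (ℓ : κ → Polynomial ℝ) {I : Set ℝ} (hz : ∀ k, z k ∈ I) (n : ℕ) (G : (Fin n → ℝ) → ℝ)
    (hG : ∀ x, (∀ i, x i ∈ I) → ∀ i,
      G x = ∑ k, (ℓ k).eval (x i) * G (Function.update x i (z k))) :
    ∃ p : MvPolynomial (Fin n) ℝ, ∀ x, (∀ i, x i ∈ I) → G x = MvPolynomial.eval x p := by
  induction n with
  | zero => exact ⟨MvPolynomial.C (G 0), fun x _ => by simp [Subsingleton.elim x 0]⟩
  | succ n ih =>
    have hcons : ∀ k (y : Fin n → ℝ), (∀ i, y i ∈ I) →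
        ∀ i, (Fin.cons (z k) y : Fin (n + 1) → ℝ) i ∈ I := fun k y hy i => by
      refine Fin.cases ?_ (fun j => ?_) i
      · simpa using hz k
      · simpa using hy j
    have h : ∀ k, ∃ p : MvPolynomial (Fin n) ℝ, ∀ y, (∀ i, y i ∈ I) →
        G (Fin.cons (z k) y) = MvPolynomial.eval y p := fun k => by
      refine ih (fun y => G (Fin.cons (z k) y)) fun y hy i => ?_
      have := hG (Fin.cons (z k) y) (hcons k y hy) i.succ
      simp only [Fin.cons_succ, ← Fin.cons_update] at this
      exact this
    choose p hp using h
    refine ⟨∑ k, Polynomial.aeval (MvPolynomial.X 0) (ℓ k) * MvPolynomial.rename Fin.succ (p k),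
      fun x hx => ?_⟩
    rw [hG x hx 0, map_sum]
    refine Finset.sum_congr rfl fun k _ => ?_
    have e : Function.update x 0 (z k) = Fin.cons (z k) (Fin.tail x) := by
      conv_lhs => rw [← Fin.cons_self_tail x]
      rw [Fin.update_cons_zero]
    rw [e, hp k (Fin.tail x) fun i => hx i.succ, map_mul, MvPolynomial.eval_rename]
    congr 1
    rw [← MvPolynomial.coe_aeval_eq_eval, RingHom.coe_coe, ← Polynomial.aeval_algHom_apply]
    simp

lemma MvPolynomial.IsHomogeneous.eval_mul_left {σ : Type*} {p : MvPolynomial σ ℝ} {m : ℕ}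
    (hp : p.IsHomogeneous m) (t : ℝ) (y : σ → ℝ) :
    MvPolynomial.eval (fun i => t * y i) p = t ^ m * MvPolynomial.eval y p := by
  rw [MvPolynomial.eval_eq, MvPolynomial.eval_eq, Finset.mul_sum]
  refine Finset.sum_congr rfl fun s hs => ?_
  have : s.degree = m := by
    by_contra h
    exact (MvPolynomial.mem_support_iff.1 hs) (hp.coeff_eq_zero h)
  simp_rw [mul_pow, Finset.prod_mul_distrib, Finset.prod_pow_eq_pow_sum]
  rw [← this, Finsupp.degree_apply]
  ring

/-- A polynomial whose restrictions to short segments from the origin have degree at most `d` has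
total degree at most `d`. -/
lemma MvPolynomial.totalDegree_le_of_segments {σ : Type*} {d : ℕ} {p : MvPolynomial σ ℝ} {c : ℝ}
    (hc : 0 < c) (h : ∀ y : σ → ℝ, (∀ i, y i ∈ Set.Icc (-c) c) →
      ∃ q : Polynomial ℝ, q.natDegree ≤ d ∧ ∀ t ∈ Set.Icc (0 : ℝ) 1,
        MvPolynomial.eval (fun i => t * y i) p = q.eval t) :
    p.totalDegree ≤ d := by
  have hzero : ∀ m, d < m → MvPolynomial.homogeneousComponent m p = 0 := by
    intro m hm
    refine MvPolynomial.funext_set (fun _ => Set.Icc (-c) c)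
      (fun _ => Set.Icc_infinite (by linarith)) fun y hy => ?_
    obtain ⟨q, hq, hqt⟩ := h y fun i => hy i (Set.mem_univ i)
    -- Along the ray through `y`, the coefficient of `t ^ m` is the degree-`m` homogeneous component
    -- at `y`; it must vanish for `m > d`.
    set Q : Polynomial ℝ := ∑ m ∈ Finset.range (p.totalDegree + 1),
      Polynomial.C (MvPolynomial.eval y (MvPolynomial.homogeneousComponent m p)) *
        Polynomial.X ^ m
    have hQ : Q = q := by
      refine Polynomial.eq_of_infinite_eval_eq _ _
        ((Set.Icc_infinite (zero_lt_one' ℝ)).mono fun t ht => ?_)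
      rw [Set.mem_ofPred_eq, ← hqt t ht]
      conv_rhs => rw [← MvPolynomial.sum_homogeneousComponent p]
      rw [map_sum, Polynomial.eval_finsetSum]
      refine Finset.sum_congr rfl fun k _ => ?_
      rw [(MvPolynomial.homogeneousComponent_isHomogeneous k p).eval_mul_left]
      rw [Polynomial.eval_mul, Polynomial.eval_C, Polynomial.eval_pow, Polynomial.eval_X, mul_comm]
    have hcoeff : Q.coeff m = 0 := by
      rw [hQ]
      exact Polynomial.coeff_eq_zero_of_natDegree_lt (by omega)
    rcases le_or_gt m p.totalDegree with hle | hlt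
    · have : MvPolynomial.eval y (MvPolynomial.homogeneousComponent m p) = 0 := by
        simpa [Q, Polynomial.finsetSum_coeff, Polynomial.coeff_X_pow, Nat.lt_succ_iff, hle]
          using hcoeff
      rw [this, map_zero]
    · rw [MvPolynomial.homogeneousComponent_eq_zero _ _ hlt]
  refine Finset.sup_le fun s hs => ?_
  by_contra hlt
  have := MvPolynomial.coeff_homogeneousComponent s.degree p s
  rw [hzero _ (by simpa [Finsupp.degree_apply, Finsupp.sum] using hlt)] at this
  exact (MvPolynomial.mem_support_iff.1 hs) (by simpa using this.symm)

/-- A function on the unit ball that is a polynomial of degree at most `d` on each segment agrees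
on a neighbourhood of the origin with a polynomial of total degree at most `d`. -/
lemma exists_mvPolynomial_of_segments {n d : ℕ} {ν : Fin (d + 1) → ℝ}
    (hν : ∀ k, ν k ∈ Set.Icc (0 : ℝ) 1) {g : EuclideanSpace ℝ (Fin n) → ℝ}
    (hg : ∀ p q, ‖p‖ ≤ 1 → ‖p + q‖ ≤ 1 → ∀ t ∈ Set.Icc (0 : ℝ) 1,
      g (p + t • q) = ∑ k, lagrangeWeight ν k t * g (p + ν k • q)) :
    ∃ P : MvPolynomial (Fin n) ℝ, P.totalDegree ≤ d ∧
      ∀ x : EuclideanSpace ℝ (Fin n), ‖x‖ ≤ 1 / ((n : ℝ) + 1) →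
        g x = MvPolynomial.eval (fun i => x i) P := by
  -- The cube of half-side `c` lies in the unit ball because `n * c ^ 2 ≤ 1`, and it contains the
  -- ball of radius `c`.
  set c : ℝ := 1 / ((n : ℝ) + 1)
  have hc : 0 < c := by positivity
  have hball : ∀ x : Fin n → ℝ, (∀ i, x i ∈ Set.Icc (-c) c) → ‖WithLp.toLp 2 x‖ ≤ 1 := by
    intro x hx
    have h1 : ‖WithLp.toLp 2 x‖ ^ 2 ≤ 1 := by
      rw [EuclideanSpace.norm_sq_eq]
      calc ∑ i, ‖x i‖ ^ 2 ≤ ∑ _i : Fin n, c * 1 := by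
            refine Finset.sum_le_sum fun i _ => ?_
            have h := abs_le.2 (hx i)
            have hc1 : c ≤ 1 := by
              rw [div_le_one (by positivity)]
              linarith [(Nat.cast_nonneg n : (0 : ℝ) ≤ n)]
            rw [Real.norm_eq_abs]
            nlinarith [abs_nonneg (x i)]
        _ = n / ((n : ℝ) + 1) := by simp [c, div_eq_mul_inv]
        _ ≤ 1 := by
            rw [div_le_one (by positivity)]
            linarith
    exact (sq_le_one_iff₀ (norm_nonneg _)).1 h1
  obtain ⟨P, hP⟩ := exists_mvPolynomial_of_separately (I := Set.Icc (-c) c)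
    (fun k => -c + ν k * (2 * c))
    (fun k => (Lagrange.basis Finset.univ ν k).comp
      (Polynomial.C (1 / (2 * c)) * (Polynomial.X + Polynomial.C c)))
    (fun k => ⟨by nlinarith [(hν k).1], by nlinarith [(hν k).2]⟩) n
    (fun x => g (WithLp.toLp 2 x)) (fun x hx i => by
      have hupd : ∀ τ, WithLp.toLp 2 (Function.update x i (-c + τ * (2 * c))) =
          WithLp.toLp 2 (Function.update x i (-c)) +
            τ • WithLp.toLp 2 (Pi.single i (2 * c) : Fin n → ℝ) := fun τ => by
        ext j
        rcases eq_or_ne j i with rfl | hj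
        · simp
        · simp [hj]
      have hmem : ∀ τ ∈ Set.Icc (-c) c, ∀ j, Function.update x i τ j ∈ Set.Icc (-c) c := by
        intro τ hτ j
        rcases eq_or_ne j i with rfl | hj
        · simpa using hτ
        · simpa [hj] using hx j
      have h1 := hball _ (hmem (-c) ⟨le_rfl, by linarith⟩)
      have h2 := hball _ (hmem (-c + 1 * (2 * c)) ⟨by linarith, by linarith⟩)
      rw [hupd, one_smul] at h2
      have ht : (x i + c) / (2 * c) ∈ Set.Icc (0 : ℝ) 1 :=
        ⟨div_nonneg (by linarith [(hx i).1]) (by linarith),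
          (div_le_one (by linarith)).2 (by linarith [(hx i).2])⟩
      have h3 := hg _ _ h1 h2 _ ht
      simp_rw [← hupd] at h3
      rw [show -c + (x i + c) / (2 * c) * (2 * c) = x i by field_simp; ring,
        Function.update_eq_self] at h3
      rw [h3]
      refine Finset.sum_congr rfl fun k _ => ?_
      simp only [lagrangeWeight, Polynomial.eval_comp, Polynomial.eval_mul, Polynomial.eval_C,
        Polynomial.eval_add, Polynomial.eval_X]
      rw [show 1 / (2 * c) * (x i + c) = (x i + c) / (2 * c) by ring])
  refine ⟨P, MvPolynomial.totalDegree_le_of_segments hc fun y hy => ?_, fun x hx => ?_⟩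
  · refine ⟨∑ k, Polynomial.C (g (ν k • WithLp.toLp 2 y)) * Lagrange.basis Finset.univ ν k,
      ?_, fun t ht => ?_⟩
    · refine Polynomial.natDegree_sum_le_of_forall_le _ _ fun k _ => ?_
      refine (Polynomial.natDegree_C_mul_le _ _).trans ?_
      by_cases hinj : Function.Injective ν
      · rw [Lagrange.natDegree_basis hinj.injOn (Finset.mem_univ _)]
        simp
      · unfold Lagrange.basis
        refine (Polynomial.natDegree_prod_le _ _).trans ?_
        refine (Finset.sum_le_sum (g := fun _ => 1) fun j _ => ?_).trans (by simp)
        unfold Lagrange.basisDivisor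
        exact (Polynomial.natDegree_C_mul_le _ _).trans (Polynomial.natDegree_X_sub_C_le _)
    · rw [← hP _ fun i => ?_]
      · have h := hg 0 (WithLp.toLp 2 y) (by simp) (by simpa using hball y hy) t ht
        simp only [zero_add] at h
        rw [show (WithLp.toLp 2 fun i => t * y i) = t • WithLp.toLp 2 y by ext; simp, h]
        simp [Polynomial.eval_finsetSum, lagrangeWeight, mul_comm]
      · constructor <;> nlinarith [(hy i).1, (hy i).2, ht.1, ht.2]
  · have hx' : ∀ i, x i ∈ Set.Icc (-c) c := fun i => by
      rw [Set.mem_Icc, ← abs_le]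
      exact (PiLp.norm_apply_le x i).trans hx
    exact hP (fun i => x i) hx'

end Polynomials

/-! ### The two laws, the nodes, and soundness of a round -/

noncomputable section

/-- Two laws on a normed space, the first much more spread out than the second, that suit the
correction of the values of a function from the points `x + s j • a` of random lines. -/
structure IsCorrectionPair {ι V : Type*} [NormedAddCommGroup V] [NormedSpace ℝ V]
    [MeasurableSpace V] (s : ι → ℝ) (ρ σ : Measure V) (R : ℝ) : Prop where
  map_wide_le : ∀ x : V, ‖x‖ ≤ R + 1 → ∀ j, ρ.map (fun a => x + s j • a) ≤ (4 : ℝ≥0) • ρ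
  map_add_wide_le : ∀ x : V, ‖x‖ ≤ R → ρ.map (fun a => x + a) ≤ (4 : ℝ≥0) • ρ
  map_narrow_le : ∀ x : V, ‖x‖ ≤ 2 → ∀ j, σ.map (fun a => x + s j • a) ≤ (4 : ℝ≥0) • σ
  radius_nonneg : 0 ≤ R
  tail_le : σ {b | R < ‖b‖} ≤ 1 / 8

/-- Distinct nodes close to `1`. -/
def nearNodes (n d : ℕ) (j : Fin (d + 1)) : ℝ :=
  1 - 1 / (2 * ((n : ℝ) + 1)) * ((j : ℝ) / ((d : ℝ) + 1))

/-- Equidistant nodes in `[0, 1]`. -/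
def unitNodes (d : ℕ) (k : Fin (d + 1)) : ℝ := (k : ℝ) / d

lemma nearNodes_injective (n d : ℕ) : Function.Injective (nearNodes n d) := by
  intro i j h
  have h1 : (1 : ℝ) / (2 * ((n : ℝ) + 1)) ≠ 0 := by positivity
  have h2 : ((d : ℝ) + 1) ≠ 0 := by positivity
  have h3 := mul_left_cancel₀ h1 (sub_right_injective h)
  rw [div_left_inj' h2] at h3
  exact Fin.ext (by exact_mod_cast h3)

lemma nearNodes_mem (n d : ℕ) (j : Fin (d + 1)) :
    nearNodes n d j ∈ Set.Icc (1 - 1 / (2 * ((n : ℝ) + 1))) 1 := by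
  have h1 : (0 : ℝ) ≤ 1 / (2 * ((n : ℝ) + 1)) := by positivity
  have h2 : (0 : ℝ) ≤ (j : ℝ) / ((d : ℝ) + 1) := by positivity
  have h3 : (j : ℝ) / ((d : ℝ) + 1) ≤ 1 := by
    rw [div_le_one (by positivity)]
    exact_mod_cast j.isLt.le
  unfold nearNodes
  constructor <;> nlinarith

lemma unitNodes_injective {d : ℕ} (hd : 1 ≤ d) : Function.Injective (unitNodes d) := by
  intro i j h
  have h2 : (d : ℝ) ≠ 0 := by positivity
  unfold unitNodes at h
  rw [div_left_inj' h2] at h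
  exact Fin.ext (by exact_mod_cast h)

lemma unitNodes_mem {d : ℕ} (k : Fin (d + 1)) : unitNodes d k ∈ Set.Icc (0 : ℝ) 1 := by
  refine ⟨by unfold unitNodes; positivity, div_le_one_of_le₀ ?_ (by positivity)⟩
  exact_mod_cast Nat.lt_succ_iff.1 k.isLt

/-- The order of choice matters: `σ` absorbs shifts by `2`, the length of a chord of the unit ball;
its tail determines `R`; then `ρ` absorbs shifts by `R + 1`, which covers both vectors of norm at
most `R` and points of the unit ball. -/
lemma exists_isCorrectionPair (n d : ℕ) :
    ∃ (ρ σ : Measure (EuclideanSpace ℝ (Fin n))) (R : ℝ), IsProbabilityMeasure ρ ∧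
      IsProbabilityMeasure σ ∧ IsCorrectionPair (nearNodes n d) ρ σ R := by
  obtain ⟨σ, hσ, hσ'⟩ := exists_isProbabilityMeasure_map_affine_le
    (V := EuclideanSpace ℝ (Fin n)) (B := 2) (by norm_num)
  obtain ⟨R, hR, hRσ⟩ := exists_measure_norm_gt_le σ (δ := 1 / 8) (by simp)
  obtain ⟨ρ, hρ, hρ'⟩ := exists_isProbabilityMeasure_map_affine_le
    (V := EuclideanSpace ℝ (Fin n)) (B := R + 1) (by positivity)
  rw [finrank_euclideanSpace_fin] at hσ' hρ'
  have h1 : 1 - 1 / (2 * ((n : ℝ) + 1)) ≤ 1 := by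
    have : (0 : ℝ) ≤ 1 / (2 * ((n : ℝ) + 1)) := by positivity
    linarith
  refine ⟨ρ, σ, R, hρ, hσ, fun x hx j => ?_, fun x hx => ?_, fun x hx j => ?_, hR, hRσ⟩
  · exact hρ' x _ hx (nearNodes_mem n d j).1 (nearNodes_mem n d j).2
  · simpa using hρ' x 1 (by linarith) h1 le_rfl
  · exact hσ' x _ hx (nearNodes_mem n d j).1 (nearNodes_mem n d j).2

/-- The coefficients that extrapolate a polynomial from the nodes close to `1` to `0`. -/
def nearWeights (n d : ℕ) (j : Fin (d + 1)) : ℝ := lagrangeWeight (nearNodes n d) j 0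

/-- The factor by which a vector is contracted to have norm less than `1 / (n + 1)`. -/
def contraction {n : ℕ} (x : EuclideanSpace ℝ (Fin n)) : ℝ := ((n : ℝ) + 1) * (1 + ‖x‖)

lemma contraction_pos {n : ℕ} (x : EuclideanSpace ℝ (Fin n)) : 0 < contraction x := by
  unfold contraction
  positivity

/-- The value at `x` extrapolated from the values at short multiples of `x`, each of them corrected
in direction `a`. -/
def correctedValue {n d : ℕ} (f : EuclideanSpace ℝ (Fin n) → ℝ) (x a : EuclideanSpace ℝ (Fin n)) :
    ℝ :=
  ∑ k : Fin (d + 1), lagrangeWeight (unitNodes d) k (contraction x) *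
    lineCombination (nearNodes n d) (nearWeights n d) f
      ((unitNodes d k * (contraction x)⁻¹) • x) a

/-- The uniform law on `[0, 1]`. -/
def uniformLaw : Measure ℝ := volume.restrict (Set.Icc 0 1)

instance : IsProbabilityMeasure uniformLaw := ⟨by simp [uniformLaw]⟩

section Soundness

variable {n d : ℕ} {ρ σ : Measure (EuclideanSpace ℝ (Fin n))} [IsProbabilityMeasure ρ]
  [IsProbabilityMeasure σ] {R : ℝ} {f : EuclideanSpace ℝ (Fin n) → ℝ} {η : ℝ≥0}

/-- If `f` passes the tests on random lines with high probability, then the corrected values near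
the origin are those of a polynomial. -/
lemma exists_mvPolynomial_popular (hd : 1 ≤ d) (hpair : IsCorrectionPair (nearNodes n d) ρ σ R)
    (hη0 : 0 < η) (hη : ((d : ℝ≥0) + 1) ^ 2 * η ≤ 1 / 1000)
    (hwide : (ρ.prod ρ)
      {p | f p.1 ≠ lineCombination (nearNodes n d) (nearWeights n d) f p.1 p.2} ≤ η)
    (hnarrow : (uniformLaw.prod (ρ.prod σ)) {z | f (z.2.1 + z.1 • z.2.2) ≠
      lineCombination (unitNodes d) (fun k => lagrangeWeight (unitNodes d) k z.1) f
        z.2.1 z.2.2} ≤ η) :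
    ∃ P : MvPolynomial (Fin n) ℝ, P.totalDegree ≤ d ∧
      ∀ x : EuclideanSpace ℝ (Fin n), ‖x‖ ≤ 1 / ((n : ℝ) + 1) →
        ρ {a | lineCombination (nearNodes n d) (nearWeights n d) f x a ≠
          MvPolynomial.eval (fun i => x i) P} ≤ ((8 * ((d : ℝ≥0) + 1) * η : ℝ≥0) : ℝ≥0∞) := by
  have hpop : ∀ x : EuclideanSpace ℝ (Fin n), ∃ y, ‖x‖ ≤ 1 →
      ρ {a | lineCombination (nearNodes n d) (nearWeights n d) f x a ≠ y} ≤
        ((8 * ((d : ℝ≥0) + 1) * η : ℝ≥0) : ℝ≥0∞) := fun x => by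
    by_cases hx : ‖x‖ ≤ 1
    · obtain ⟨y, hy⟩ := exists_measure_lineCombination_ne_le
        (hpair.map_wide_le x (by linarith [hpair.radius_nonneg])) hwide
      refine ⟨y, fun _ => hy.trans (le_of_eq ?_)⟩
      rw [Fintype.card_fin]
      push_cast
      ring
    · exact ⟨0, fun h => absurd h hx⟩
  choose g hg using hpop
  set M : Set (ℝ × EuclideanSpace ℝ (Fin n) × EuclideanSpace ℝ (Fin n)) :=
    {z | f (z.2.1 + z.1 • z.2.2) ≠
      lineCombination (unitNodes d) (fun k => lagrangeWeight (unitNodes d) k z.1) f z.2.1 z.2.2}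
  -- By Markov's inequality, the narrow relation fails with probability at least `10 * η` for at
  -- most a tenth of the parameters.
  set Z : Set ℝ := {t | ((10 * η : ℝ≥0) : ℝ≥0∞) ≤ (ρ.prod σ) (Prod.mk t ⁻¹' M)}
  have hZ : volume (Z ∩ Set.Icc 0 1) ≤ 1 / 10 := by
    have h := (measure_le_slice_mul_le (μ := uniformLaw) (ν := ρ.prod σ) M
      ((10 * η : ℝ≥0) : ℝ≥0∞)).trans hnarrow
    have hr : uniformLaw Z = volume (Z ∩ Set.Icc 0 1) := Measure.restrict_apply' measurableSet_Icc
    change _ * uniformLaw Z ≤ _ at h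
    rw [hr] at h
    rw [ENNReal.le_div_iff_mul_le (by simp) (by simp)]
    have hη' : (η : ℝ≥0∞) ≠ 0 := by simpa using hη0.ne'
    rw [← ENNReal.mul_le_mul_iff_right hη' ENNReal.coe_ne_top]
    calc _ = ((10 * η : ℝ≥0) : ℝ≥0∞) * volume (Z ∩ Set.Icc 0 1) := by push_cast; ring
      _ ≤ η * 1 := by rwa [mul_one]
  -- With `(d + 1) ^ 2 * η ≤ 1/1000`, the terms are at most `0.125`, `0.064` and `0.16`.
  have hsmall : (1 : ℝ≥0∞) / 8 + ((Fintype.card (Fin (d + 1)) + 1) *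
      (4 * ((8 * ((d : ℝ≥0) + 1) * η : ℝ≥0) : ℝ≥0∞)) +
        Fintype.card (Fin (d + 1)) * (16 * ((10 * η : ℝ≥0) : ℝ≥0∞))) < 1 := by
    rw [Fintype.card_fin]
    have h : (1 / 8 + (((d + 1 : ℕ) + 1) * (4 * (8 * ((d : ℝ≥0) + 1) * η)) +
        (d + 1 : ℕ) * (16 * (10 * η))) : ℝ≥0) < 1 := by
      rw [← NNReal.coe_lt_coe]
      have hη1 : ((d : ℝ) + 1) ^ 2 * η ≤ 1 / 1000 := by exact_mod_cast hη
      push_cast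
      have hdη : 0 ≤ (d : ℝ) * η := by positivity
      have hddη : 0 ≤ (d : ℝ) * (d * η) := by positivity
      have hη2 : (0 : ℝ) ≤ η := η.2
      nlinarith
    have h' : ((1 / 8 + (((d + 1 : ℕ) + 1) * (4 * (8 * ((d : ℝ≥0) + 1) * η)) +
        (d + 1 : ℕ) * (16 * (10 * η))) : ℝ≥0) : ℝ≥0∞) < 1 := by exact_mod_cast h
    refine lt_of_eq_of_lt ?_ h'
    push_cast
    rw [ENNReal.coe_div (by norm_num)]
    norm_num
  have hseg : ∀ t ∈ Set.Icc (0 : ℝ) 1, t ∉ Z → ∀ p q, ‖p‖ ≤ 1 → ‖p + q‖ ≤ 1 →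
      g (p + t • q) = ∑ k, lagrangeWeight (unitNodes d) k t * g (p + unitNodes d k • q) :=
    fun t ht htZ p q hp hpq => lineCombination_eq_of_popular hpair.map_wide_le
      hpair.map_add_wide_le hpair.map_narrow_le hpair.radius_nonneg hpair.tail_le hg ht
      unitNodes_mem (not_le.1 htZ).le hsmall hp hpq
  obtain ⟨P, hP, hPg⟩ := exists_mvPolynomial_of_segments (g := g) (d := d) unitNodes_mem
    fun p q hp hpq t ht => by
      have hin : ∀ τ ∈ Set.Icc (0 : ℝ) 1, ‖p + τ • q‖ ≤ 1 := fun τ hτ => by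
        have := (convex_closedBall (0 : EuclideanSpace ℝ (Fin n)) 1).add_smul_mem
          (x := p) (y := q) (by simpa using hp) (by simpa using hpq) hτ
        simpa using this
      refine eq_lagrange_of_eq_outside (φ := fun t => g (p + t • q)) (unitNodes_injective hd)
        (by simp [unitNodes]) hZ (fun x hx y hy t ht htZ => ?_) ht
      have h := hseg t ht htZ (p + x • q) ((y - x) • q) (hin x hx) (by
        rw [add_assoc, ← add_smul, add_sub_cancel]
        exact hin y hy)
      simpa only [add_assoc, smul_smul, ← add_smul] using h
  refine ⟨P, hP, fun x hx => ?_⟩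
  rw [← hPg x hx]
  refine hg x (hx.trans ?_)
  rw [div_le_one (by positivity)]
  linarith [(Nat.cast_nonneg n : (0 : ℝ) ≤ n)]

/-- If `f` passes the tests on random lines with high probability, and most of its values at samples
from `D` are those obtained by correction, then `f` is close to a polynomial over `D`. -/
lemma exists_mvPolynomial_measure_ne_le (hd : 1 ≤ d)
    (hpair : IsCorrectionPair (nearNodes n d) ρ σ R)
    (hη0 : 0 < η) (hη : ((d : ℝ≥0) + 1) ^ 2 * η ≤ 1 / 1000)
    (hwide : (ρ.prod ρ)
      {p | f p.1 ≠ lineCombination (nearNodes n d) (nearWeights n d) f p.1 p.2} ≤ η)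
    (hnarrow : (uniformLaw.prod (ρ.prod σ)) {z | f (z.2.1 + z.1 • z.2.2) ≠
      lineCombination (unitNodes d) (fun k => lagrangeWeight (unitNodes d) k z.1) f
        z.2.1 z.2.2} ≤ η)
    {D : Measure (EuclideanSpace ℝ (Fin n))} [IsProbabilityMeasure D] :
    ∃ P : MvPolynomial (Fin n) ℝ, P.totalDegree ≤ d ∧
      1 / 2 * D {x | f x ≠ MvPolynomial.eval (fun i => x i) P} ≤
        (D.prod ρ) {z | f z.1 ≠ correctedValue (d := d) f z.1 z.2} := by
  obtain ⟨P, hPd, hP⟩ := exists_mvPolynomial_popular hd hpair hη0 hη hwide hnarrow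
  refine ⟨P, hPd, ?_⟩
  -- The corrected value at any `x` equals `P x` with probability at least `1/2`, so each `x` with
  -- `f x ≠ P x` is detected with that probability.
  refine le_trans ?_ (measure_le_slice_mul_le (μ := D) (ν := ρ) _ (1 / 2))
  gcongr with x
  intro hx
  set N := {a | correctedValue (d := d) f x a ≠ MvPolynomial.eval (fun i => x i) P}
  have hN : ρ N ≤ 1 / 2 := by
    have hsub : N ⊆ ⋃ k : Fin (d + 1), {a | lineCombination (nearNodes n d) (nearWeights n d) f
        ((unitNodes d k * (contraction x)⁻¹) • x) a ≠
          MvPolynomial.eval (fun i => ((unitNodes d k * (contraction x)⁻¹) • x) i) P} := by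
      intro a ha
      by_contra hcon
      simp only [Set.mem_iUnion, Set.mem_ofPred_eq, not_exists, not_not] at hcon
      refine ha ?_
      -- On the ray with direction `(contraction x)⁻¹ • x`, the nodes lie in the small ball where
      -- `P` is known, and `x` is at parameter `contraction x`.
      have h := MvPolynomial.eval_line_eq_sum (unitNodes_injective hd) hPd 0
        (fun i => (contraction x)⁻¹ * x i) (contraction x)
      simp only [Pi.zero_apply, zero_add, ← mul_assoc, mul_inv_cancel₀ (contraction_pos x).ne',
        one_mul] at h
      rw [h]
      refine Finset.sum_congr rfl fun k _ => ?_
      rw [hcon k]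
      simp only [PiLp.smul_apply, smul_eq_mul]
    refine (measure_mono hsub).trans ((measure_iUnion_fintype_le _ _).trans
      ((Finset.sum_le_sum fun k _ => hP _ ?_).trans ?_))
    · rw [norm_smul, Real.norm_eq_abs, abs_of_nonneg
        (mul_nonneg (unitNodes_mem k).1 (inv_nonneg.2 (contraction_pos x).le))]
      have h1 : (contraction x)⁻¹ * ‖x‖ ≤ 1 / ((n : ℝ) + 1) := by
        unfold contraction
        rw [inv_mul_eq_div, div_le_div_iff₀ (by positivity) (by positivity)]
        nlinarith [norm_nonneg x, (Nat.cast_nonneg n : (0 : ℝ) ≤ n)]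
      rw [mul_assoc]
      exact (mul_le_of_le_one_left (mul_nonneg (inv_nonneg.2 (contraction_pos x).le)
        (norm_nonneg x)) (unitNodes_mem k).2).trans h1
    · rw [Finset.sum_const, Finset.card_univ, Fintype.card_fin, nsmul_eq_mul]
      have h : (((d + 1 : ℕ) * (8 * ((d : ℝ≥0) + 1) * η)) : ℝ≥0) ≤ 1 / 2 := by
        rw [← NNReal.coe_le_coe]
        have hη1 : ((d : ℝ) + 1) ^ 2 * η ≤ 1 / 1000 := by exact_mod_cast hη
        push_cast
        nlinarith
      have h' : ((((d + 1 : ℕ) * (8 * ((d : ℝ≥0) + 1) * η)) : ℝ≥0) : ℝ≥0∞) ≤ ((1 / 2 : ℝ≥0)) := by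
        exact_mod_cast h
      refine le_trans (le_of_eq ?_) (h'.trans (le_of_eq ?_))
      · push_cast; ring
      · rw [ENNReal.coe_div (by norm_num)]; norm_num
  have hone : (1 : ℝ≥0∞) ≤ ρ (Prod.mk x ⁻¹' {z | f z.1 ≠ correctedValue (d := d) f z.1 z.2}) +
      ρ N := by
    rw [← measure_univ (μ := ρ)]
    refine (measure_mono fun a _ => ?_).trans (measure_union_le _ _)
    by_cases ha : a ∈ N
    · exact Or.inr ha
    · refine Or.inl fun h => hx ?_
      exact h.trans (not_not.1 ha)
  have h2 : (1 : ℝ≥0∞) / 2 + 1 / 2 = 1 := ENNReal.add_halves 1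
  rw [← h2] at hone
  exact (ENNReal.add_le_add_iff_right (by simp)).1
    (hone.trans (add_le_add_right hN _))

end Soundness

end

/-! ### The tester: nonadaptive queries and independent rounds -/

noncomputable section

section Nonadaptive

variable {E Coins ι : Type} [MeasurableSpace E] [Inhabited E] [MeasurableSpace Coins]
  [StandardBorelSpace Coins] [Fintype ι]

/-- The tester that queries, for given coins and samples, a fixed family of points. -/
def nonadaptiveTester (coinLaw : Measure Coins) [IsProbabilityMeasure coinLaw] (k : ℕ)
    (point : ι → Coins × (Fin k → E) → E) (hpoint : ∀ i, Measurable (point i))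
    (acc : Set (Coins × (Fin k → E) × (ι → ℝ))) (hacc : MeasurableSet acc) : OracleTester E where
  Coins := Coins
  coinLaw := coinLaw
  numSamples := k
  numQueries := Fintype.card ι
  query i z :=
    if h : i < Fintype.card ι then point ((Fintype.equivFin ι).symm ⟨i, h⟩) (z.1, z.2.1) else default
  measurable_query i := by
    by_cases h : i < Fintype.card ι
    · simp only [h, dite_true]
      exact (hpoint _).comp (by fun_prop)
    · simp only [h, dite_false]
      exact measurable_const
  acceptSet := {z | (z.1, z.2.1, fun i => z.2.2 (Fintype.equivFin ι i)) ∈ acc}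
  measurableSet_acceptSet := by
    have : Measurable fun z : Coins × (Fin k → E) × (Fin (Fintype.card ι) → ℝ) =>
        (z.1, z.2.1, fun i => z.2.2 (Fintype.equivFin ι i)) := by fun_prop
    exact this hacc

variable {coinLaw : Measure Coins} [IsProbabilityMeasure coinLaw] {k : ℕ}
  {point : ι → Coins × (Fin k → E) → E} {hpoint : ∀ i, Measurable (point i)}
  {acc : Set (Coins × (Fin k → E) × (ι → ℝ))} {hacc : MeasurableSet acc}

lemma nonadaptiveTester_answers (f : E → ℝ) (c : Coins) (s : Fin k → E) (i : ℕ)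
    (hi : i ≤ Fintype.card ι) (j : Fin i) :
    (nonadaptiveTester coinLaw k point hpoint acc hacc).answers f c s i j =
      f (point ((Fintype.equivFin ι).symm ⟨j, j.isLt.trans_le hi⟩) (c, s)) := by
  induction i with
  | zero => exact j.elim0
  | succ i ih =>
    refine Fin.lastCases ?_ (fun j => ?_) j
    · have hlt : i < Fintype.card ι := hi
      simp only [OracleTester.answers, Fin.snoc_last]
      simp [nonadaptiveTester, hlt]
    · simp only [OracleTester.answers, Fin.snoc_castSucc]
      exact ih (by omega) j

lemma nonadaptiveTester_accepts_iff (f : E → ℝ) (c : Coins) (s : Fin k → E) :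
    (nonadaptiveTester coinLaw k point hpoint acc hacc).Accepts f c s ↔
      (c, s, fun i => f (point i (c, s))) ∈ acc := by
  have : (fun i => (nonadaptiveTester coinLaw k point hpoint acc hacc).answers f c s
      (Fintype.card ι) (Fintype.equivFin ι i)) = fun i => f (point i (c, s)) := by
    funext i
    rw [nonadaptiveTester_answers f c s _ le_rfl]
    simp
  rw [← this]
  rfl

end Nonadaptive

section Rounds

/-- The coins of a round: two points for the test on wide lines, a parameter and two points for the
test on narrow lines, and a direction for the correction of a value. -/
abbrev RoundCoins (n : ℕ) : Type :=
  ((EuclideanSpace ℝ (Fin n) × EuclideanSpace ℝ (Fin n)) ×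
    (ℝ × (EuclideanSpace ℝ (Fin n) × EuclideanSpace ℝ (Fin n)))) × EuclideanSpace ℝ (Fin n)

instance (n : ℕ) : StandardBorelSpace (RoundCoins n) := by
  have h : StandardBorelSpace (EuclideanSpace ℝ (Fin n) × EuclideanSpace ℝ (Fin n)) :=
    inferInstance
  have h' : StandardBorelSpace (ℝ × (EuclideanSpace ℝ (Fin n) × EuclideanSpace ℝ (Fin n))) :=
    StandardBorelSpace.prod
  have h'' := @StandardBorelSpace.prod _ _ _ _ h h'
  exact StandardBorelSpace.prod

/-- The law of the coins of a round. -/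
def roundLaw {n : ℕ} (ρ σ : Measure (EuclideanSpace ℝ (Fin n))) : Measure (RoundCoins n) :=
  ((ρ.prod ρ).prod (uniformLaw.prod (ρ.prod σ))).prod ρ

instance {n : ℕ} (ρ σ : Measure (EuclideanSpace ℝ (Fin n))) [IsProbabilityMeasure ρ]
    [IsProbabilityMeasure σ] : IsProbabilityMeasure (roundLaw ρ σ) := by
  unfold roundLaw
  infer_instance

/-- The indices of the queries of a round. -/
abbrev RoundQuery (d : ℕ) : Type :=
  Option (Fin (d + 1)) ⊕ Option (Fin (d + 1)) ⊕ Option (Fin (d + 1) × Fin (d + 1))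

/-- The points queried in a round. -/
def roundPoint {n d : ℕ} : RoundQuery d → RoundCoins n × EuclideanSpace ℝ (Fin n) →
    EuclideanSpace ℝ (Fin n)
  | .inl none, z => z.1.1.1.1
  | .inl (some j), z => z.1.1.1.1 + nearNodes n d j • z.1.1.1.2
  | .inr (.inl none), z => z.1.1.2.2.1 + z.1.1.2.1 • z.1.1.2.2.2
  | .inr (.inl (some k)), z => z.1.1.2.2.1 + unitNodes d k • z.1.1.2.2.2
  | .inr (.inr none), z => z.2
  | .inr (.inr (some (k, j))), z =>
    (unitNodes d k * (contraction z.2)⁻¹) • z.2 + nearNodes n d j • z.1.2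

/-- The coins, samples and answers of a round on which all its tests are passed. -/
def roundAccept (n d : ℕ) :
    Set (RoundCoins n × EuclideanSpace ℝ (Fin n) × (RoundQuery d → ℝ)) :=
  {z | z.2.2 (.inl none) = ∑ j, nearWeights n d j * z.2.2 (.inl (some j))} ∩
  ({z | z.2.2 (.inr (.inl none)) =
    ∑ k, lagrangeWeight (unitNodes d) k z.1.1.2.1 * z.2.2 (.inr (.inl (some k)))} ∩
  {z | z.2.2 (.inr (.inr none)) =
    ∑ k, lagrangeWeight (unitNodes d) k (contraction z.2.1) *
      ∑ j, nearWeights n d j * z.2.2 (.inr (.inr (some (k, j))))})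

lemma measurable_lagrangeWeight {d : ℕ} (ν : Fin (d + 1) → ℝ) (k : Fin (d + 1)) :
    Measurable (lagrangeWeight ν k) :=
  (Lagrange.basis Finset.univ ν k).continuous.measurable

lemma measurable_contraction {n : ℕ} :
    Measurable (contraction : EuclideanSpace ℝ (Fin n) → ℝ) := by
  unfold contraction
  fun_prop

lemma measurable_roundPoint {n d : ℕ} (q : RoundQuery d) :
    Measurable (roundPoint q : RoundCoins n × EuclideanSpace ℝ (Fin n) → _) := by
  have := measurable_contraction (n := n)
  rcases q with (_ | j) | (_ | k) | (_ | ⟨k, j⟩) <;> unfold roundPoint <;> fun_prop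

lemma measurableSet_roundAccept (n d : ℕ) : MeasurableSet (roundAccept n d) := by
  have := measurable_contraction (n := n)
  have := fun k => measurable_lagrangeWeight (unitNodes d) k
  refine (measurableSet_eq_fun ?_ ?_).inter
    ((measurableSet_eq_fun ?_ ?_).inter (measurableSet_eq_fun ?_ ?_)) <;> fun_prop

/-- The coins and samples on which a round detects an inconsistency of `f`. -/
def roundReject {n : ℕ} (d : ℕ) (f : EuclideanSpace ℝ (Fin n) → ℝ) :
    Set (RoundCoins n × EuclideanSpace ℝ (Fin n)) :=
  {z | (z.1, z.2, fun q : RoundQuery d => f (roundPoint q z)) ∉ roundAccept n d}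

lemma mem_roundReject_iff {n d : ℕ} {f : EuclideanSpace ℝ (Fin n) → ℝ}
    {z : RoundCoins n × EuclideanSpace ℝ (Fin n)} :
    z ∈ roundReject d f ↔
      f z.1.1.1.1 ≠ lineCombination (nearNodes n d) (nearWeights n d) f z.1.1.1.1 z.1.1.1.2 ∨
      f (z.1.1.2.2.1 + z.1.1.2.1 • z.1.1.2.2.2) ≠ lineCombination (unitNodes d)
        (fun k => lagrangeWeight (unitNodes d) k z.1.1.2.1) f z.1.1.2.2.1 z.1.1.2.2.2 ∨
      f z.2 ≠ correctedValue (d := d) f z.2 z.1.2 := by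
  simp only [roundReject, roundAccept, Set.mem_ofPred_eq, Set.mem_inter_iff, not_and_or]
  rfl

/-- A polynomial passes all tests. -/
lemma roundReject_eq_empty {n d : ℕ} (hd : 1 ≤ d) {f : EuclideanSpace ℝ (Fin n) → ℝ}
    (hf : f ∈ polynomialsOfDegreeLE n d) : roundReject d f = ∅ := by
  obtain ⟨p, hp, hfp⟩ := hf
  have hline : ∀ {ν : Fin (d + 1) → ℝ}, Function.Injective ν →
      ∀ (x a : EuclideanSpace ℝ (Fin n)) (t : ℝ),
        f (x + t • a) = lineCombination ν (fun k => lagrangeWeight ν k t) f x a := by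
    intro ν hν x a t
    have h := MvPolynomial.eval_line_eq_sum hν hp (fun i => x i) (fun i => a i) t
    simpa only [lineCombination, hfp, PiLp.add_apply, PiLp.smul_apply, smul_eq_mul] using h
  have hnear : ∀ x a, f x = lineCombination (nearNodes n d) (nearWeights n d) f x a := by
    intro x a
    have h := hline (nearNodes_injective n d) x a 0
    rwa [zero_smul, add_zero] at h
  refine Set.eq_empty_of_forall_notMem fun z hz => ?_
  rcases mem_roundReject_iff.1 hz with h | h | h
  · exact h (hnear _ _)
  · exact h (hline (unitNodes_injective hd) _ _ _)
  · refine h ?_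
    unfold correctedValue
    simp_rw [← hnear]
    have h := hline (unitNodes_injective hd) 0 ((contraction z.2)⁻¹ • z.2) (contraction z.2)
    simp only [lineCombination, zero_add, smul_smul,
      mul_inv_cancel₀ (contraction_pos z.2).ne', one_smul] at h
    exact h

/-- The repetition of `m` independent rounds. -/
def lineTester (n d m : ℕ) (ρ σ : Measure (EuclideanSpace ℝ (Fin n))) [IsProbabilityMeasure ρ]
    [IsProbabilityMeasure σ] : OracleTester (EuclideanSpace ℝ (Fin n)) :=
  nonadaptiveTester (ι := Fin m × RoundQuery d) (Measure.pi fun _ : Fin m => roundLaw ρ σ) m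
    (fun i z => roundPoint i.2 (z.1 i.1, z.2 i.1))
    (fun i => (measurable_roundPoint i.2).comp (by fun_prop))
    {z | ∀ i, (z.1 i, z.2.1 i, fun q => z.2.2 (i, q)) ∈ roundAccept n d}
    (by
      have : {z : (Fin m → RoundCoins n) × (Fin m → EuclideanSpace ℝ (Fin n)) ×
          (Fin m × RoundQuery d → ℝ) |
          ∀ i, (z.1 i, z.2.1 i, fun q => z.2.2 (i, q)) ∈ roundAccept n d} =
          ⋂ i, (fun z => (z.1 i, z.2.1 i, fun q => z.2.2 (i, q))) ⁻¹' roundAccept n d := by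
        ext z
        simp
      rw [this]
      refine MeasurableSet.iInter fun i => ?_
      exact (show Measurable _ by fun_prop) (measurableSet_roundAccept n d))

variable {n d m : ℕ} {ρ σ : Measure (EuclideanSpace ℝ (Fin n))} [IsProbabilityMeasure ρ]
  [IsProbabilityMeasure σ] {D : Measure (EuclideanSpace ℝ (Fin n))} [IsProbabilityMeasure D]
  {f : EuclideanSpace ℝ (Fin n) → ℝ}

lemma not_lineTester_accepts_iff (c : Fin m → RoundCoins n) (s : Fin m → EuclideanSpace ℝ (Fin n)) :
    ¬ (lineTester n d m ρ σ).Accepts f c s ↔ ∃ i, (c i, s i) ∈ roundReject d f := by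
  unfold lineTester
  rw [nonadaptiveTester_accepts_iff]
  simp only [Set.mem_ofPred_eq, not_forall]
  rfl

lemma lineTester_acceptProb (hd : 1 ≤ d) (hf : f ∈ polynomialsOfDegreeLE n d) :
    (lineTester n d m ρ σ).acceptProb D f = 1 := by
  have : {ω : (lineTester n d m ρ σ).Coins × (Fin (lineTester n d m ρ σ).numSamples →
      EuclideanSpace ℝ (Fin n)) | (lineTester n d m ρ σ).Accepts f ω.1 ω.2} = Set.univ := by
    refine Set.eq_univ_of_forall fun ω => ?_
    by_contra hω
    obtain ⟨i, hi⟩ := (not_lineTester_accepts_iff _ _).1 hω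
    rw [roundReject_eq_empty hd hf] at hi
    exact hi
  unfold OracleTester.acceptProb OracleTester.runLaw
  rw [this]
  exact probReal_univ

/-- The run law is on pairs of tuples, the repetition bound on tuples of pairs; the measurable
equivalence between them preserves outer measures too. -/
lemma one_sub_pow_le_lineTester_runLaw {η : ℝ≥0∞}
    (hη : η ≤ ((roundLaw ρ σ).prod D) (roundReject d f)) :
    1 - (1 - η) ^ m ≤ (lineTester n d m ρ σ).runLaw D
      {ω | ¬ (lineTester n d m ρ σ).Accepts f ω.1 ω.2} := by
  refine (one_sub_pow_le_measure_pi hη m).trans (le_of_eq ?_)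
  have h := (measurePreserving_arrowProdEquivProdArrow (RoundCoins n) (EuclideanSpace ℝ (Fin n))
    (Fin m) (fun _ => roundLaw ρ σ) (fun _ => D)).measure_preimage_equiv
    {ω | ¬ (lineTester n d m ρ σ).Accepts f ω.1 ω.2}
  refine Eq.trans ?_ h
  congr 1
  ext ω
  exact (not_lineTester_accepts_iff (ρ := ρ) (σ := σ) (fun i => (ω i).1) (fun i => (ω i).2)).symm

/-- If a round rarely rejects `f`, then `f` is close to a polynomial over `D`. -/
lemma exists_mvPolynomial_of_roundReject {R : ℝ} {η : ℝ≥0} (hd : 1 ≤ d)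
    (hpair : IsCorrectionPair (nearNodes n d) ρ σ R)
    (hη0 : 0 < η) (hη : ((d : ℝ≥0) + 1) ^ 2 * η ≤ 1 / 1000)
    (h : ((roundLaw ρ σ).prod D) (roundReject d f) ≤ η) :
    ∃ P : MvPolynomial (Fin n) ℝ, P.totalDegree ≤ d ∧
      1 / 2 * D {x | f x ≠ MvPolynomial.eval (fun i => x i) P} ≤ η := by
  set N₁ : Set (EuclideanSpace ℝ (Fin n) × EuclideanSpace ℝ (Fin n)) :=
    {p | f p.1 ≠ lineCombination (nearNodes n d) (nearWeights n d) f p.1 p.2} with hN₁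
  set N₂ : Set (ℝ × (EuclideanSpace ℝ (Fin n) × EuclideanSpace ℝ (Fin n))) :=
    {z | f (z.2.1 + z.1 • z.2.2) ≠ lineCombination (unitNodes d)
      (fun k => lagrangeWeight (unitNodes d) k z.1) f z.2.1 z.2.2} with hN₂
  set N₃ : Set (EuclideanSpace ℝ (Fin n) × EuclideanSpace ℝ (Fin n)) :=
    {z | f z.1 ≠ correctedValue (d := d) f z.1 z.2} with hN₃
  have h₁ : (ρ.prod ρ) N₁ ≤ η := by
    -- Failure of one test is a cylinder inside the rejection event, so its outer measure is at most
    -- `η`.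
    have hsub : ((N₁ ×ˢ (Set.univ : Set (ℝ × (EuclideanSpace ℝ (Fin n) ×
        EuclideanSpace ℝ (Fin n))))) ×ˢ (Set.univ : Set (EuclideanSpace ℝ (Fin n)))) ×ˢ
          (Set.univ : Set (EuclideanSpace ℝ (Fin n))) ⊆ roundReject d f :=
      fun z hz => mem_roundReject_iff.2 (Or.inl hz.1.1.1)
    have h' := (measure_mono hsub).trans h
    rw [roundLaw] at h'
    simpa only [Measure.prod_prod, measure_univ, mul_one] using h'
  have h₂ : (uniformLaw.prod (ρ.prod σ)) N₂ ≤ η := by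
    have hsub : (((Set.univ : Set (EuclideanSpace ℝ (Fin n) × EuclideanSpace ℝ (Fin n))) ×ˢ N₂) ×ˢ
        (Set.univ : Set (EuclideanSpace ℝ (Fin n)))) ×ˢ
          (Set.univ : Set (EuclideanSpace ℝ (Fin n))) ⊆ roundReject d f :=
      fun z hz => mem_roundReject_iff.2 (Or.inr (Or.inl hz.1.1.2))
    have h' := (measure_mono hsub).trans h
    rw [roundLaw] at h'
    simpa only [Measure.prod_prod, measure_univ, mul_one, one_mul] using h'
  have h₃ : (D.prod ρ) N₃ ≤ η := by
    set κ := (ρ.prod ρ).prod (uniformLaw.prod (ρ.prod σ))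
    have e₁ : (ρ.prod D) (Prod.swap ⁻¹' N₃) = (D.prod ρ) N₃ :=
      (Measure.measurePreserving_swap (μ := ρ) (ν := D)).measure_preimage_equiv
        (f := MeasurableEquiv.prodComm) N₃
    have e₂ := (measurePreserving_prodAssoc κ ρ D).measure_preimage_equiv
      (Set.univ ×ˢ (Prod.swap ⁻¹' N₃))
    rw [Measure.prod_prod, measure_univ, one_mul, e₁] at e₂
    rw [← e₂]
    refine (measure_mono fun z hz => ?_).trans h
    exact mem_roundReject_iff.2 (Or.inr (Or.inr hz.2))
  obtain ⟨P, hPd, hP⟩ := exists_mvPolynomial_measure_ne_le hd hpair hη0 hη h₁ h₂ (D := D)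
  exact ⟨P, hPd, hP.trans h₃⟩

end Rounds

end

/-! ### Number of rounds, cost, and the theorem -/

noncomputable section

section Main

variable {n d m : ℕ} {ρ σ : Measure (EuclideanSpace ℝ (Fin n))} [IsProbabilityMeasure ρ]
  [IsProbabilityMeasure σ] {D : Measure (EuclideanSpace ℝ (Fin n))} [IsProbabilityMeasure D]
  {f : EuclideanSpace ℝ (Fin n) → ℝ}

/-- A round makes `d + 2` queries in each line test and `(d + 1) ^ 2 + 1` in the sample test, and
draws one sample. -/
lemma lineTester_cost : ((lineTester n d m ρ σ).numQueries : ℝ) + (lineTester n d m ρ σ).numSamples =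
    m * ((d : ℝ) ^ 2 + 4 * d + 7) := by
  have h1 : (lineTester n d m ρ σ).numQueries = Fintype.card (Fin m × RoundQuery d) := rfl
  have h2 : (lineTester n d m ρ σ).numSamples = m := rfl
  rw [h1, h2]
  simp only [Fintype.card_prod, Fintype.card_fin, Fintype.card_sum, Fintype.card_option]
  push_cast
  ring

/-- If a round rejected with probability below `η`, then `f` would be within `2 * η ≤ ε` of a
polynomial. Hence all `m` rounds accept with probability at most `exp (-η * m) ≤ 1 / (1 + η * m) ≤
1/3`. -/
lemma two_thirds_le_lineTester_rejectProb {R ε : ℝ} {η : ℝ≥0} (hd : 1 ≤ d)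
    (hpair : IsCorrectionPair (nearNodes n d) ρ σ R)
    (hη0 : 0 < η) (hη : ((d : ℝ≥0) + 1) ^ 2 * η ≤ 1 / 1000) (hηε : (η : ℝ) ≤ ε / 2)
    (hm : 2 ≤ η * m) (hf : IsFar D (polynomialsOfDegreeLE n d) ε f) :
    2 / 3 ≤ (lineTester n d m ρ σ).rejectProb D f := by
  have hη1 : η ≤ 1 := by
    rw [← NNReal.coe_le_coe]
    have hη1 : ((d : ℝ) + 1) ^ 2 * η ≤ 1 / 1000 := by exact_mod_cast hη
    have : (1 : ℝ) ≤ ((d : ℝ) + 1) ^ 2 := one_le_pow₀ (by simp)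
    push_cast
    nlinarith [η.2]
  have hround : (η : ℝ≥0∞) ≤ ((roundLaw ρ σ).prod D) (roundReject d f) := by
    by_contra! hlt
    obtain ⟨P, hPd, hP⟩ := exists_mvPolynomial_of_roundReject hd hpair hη0 hη hlt.le
    have h := hf (fun x => MvPolynomial.eval (fun i => x i) P) ⟨P, hPd, fun _ => rfl⟩
    have h' := ENNReal.toReal_mono ENNReal.coe_ne_top hP
    rw [ENNReal.toReal_mul] at h'
    simp only [ENNReal.toReal_div, ENNReal.toReal_one, ENNReal.toReal_ofNat,
      ENNReal.coe_toReal] at h'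
    simp only [Measure.real] at h
    linarith
  have hpow : (1 - (η : ℝ)) ^ m ≤ 1 / 3 := by
    have hη1' : (η : ℝ) ≤ 1 := by exact_mod_cast hη1
    have hm' : (2 : ℝ) ≤ η * m := by exact_mod_cast hm
    calc (1 - (η : ℝ)) ^ m ≤ (Real.exp (-η)) ^ m :=
          pow_le_pow_left₀ (by linarith) (Real.one_sub_le_exp_neg _) m
      _ = (Real.exp (η * m))⁻¹ := by
          rw [← Real.exp_nat_mul, ← Real.exp_neg]
          congr 1
          ring
      _ ≤ 1 / 3 := by
          rw [one_div]
          exact inv_anti₀ (by norm_num) (by linarith [Real.add_one_le_exp ((η : ℝ) * m)])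
  have hrun := one_sub_pow_le_lineTester_runLaw (m := m) hround
  have : IsProbabilityMeasure ((lineTester n d m ρ σ).runLaw D) := by
    unfold OracleTester.runLaw
    infer_instance
  have hreal := ENNReal.toReal_mono (measure_ne_top _ _) hrun
  have hcoe : (1 - (1 - (η : ℝ≥0∞)) ^ m) = ((1 - (1 - η) ^ m : ℝ≥0) : ℝ≥0∞) := by
    push_cast
    rfl
  rw [hcoe, ENNReal.coe_toReal, NNReal.coe_sub (pow_le_one' tsub_le_self m), NNReal.coe_pow,
    NNReal.coe_sub hη1, NNReal.coe_one] at hreal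
  unfold OracleTester.rejectProb Measure.real
  linarith

/-- The cost is of order `d ^ 4 + d ^ 2 / ε`. The logarithm is at least `1/2` for `ε ≤ 1/2`; for
larger `ε`, where it may be tiny, `d ^ 2 / ε ≤ 2 * d ^ 2` is absorbed by `d ^ 5`. -/
lemma lineTester_budget {d : ℕ} (hd : 1 ≤ d) {ε : ℝ} (hε0 : 0 < ε) (hε1 : ε < 1) {m : ℝ}
    (hm : m ≤ 2001 * ((d : ℝ) + 1) ^ 2 + 4 / ε) :
    m * ((d : ℝ) ^ 2 + 4 * d + 7) ≤
      100000 * ((d : ℝ) ^ 5 + (d : ℝ) ^ 2 / ε * Real.log (1 / ε)) := by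
  have hd1 : (1 : ℝ) ≤ d := by exact_mod_cast hd
  have hlog : 0 ≤ Real.log (1 / ε) := Real.log_nonneg (by rw [le_div_iff₀ hε0]; linarith)
  have h4 : (d : ℝ) ^ 4 ≤ (d : ℝ) ^ 5 := pow_le_pow_right₀ hd1 (by norm_num)
  have h2 : (d : ℝ) ^ 2 ≤ (d : ℝ) ^ 5 := pow_le_pow_right₀ hd1 (by norm_num)
  have hdε : 0 ≤ (d : ℝ) ^ 2 / ε := by positivity
  have hmain : (d : ℝ) ^ 2 / ε ≤ 2 * (d : ℝ) ^ 5 + 2 * ((d : ℝ) ^ 2 / ε * Real.log (1 / ε)) := by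
    rcases le_or_gt ε (1 / 2) with h | h
    · have : 1 / 2 ≤ Real.log (1 / ε) := by
        have h1 : Real.log 2 ≤ Real.log (1 / ε) :=
          Real.log_le_log (by norm_num) (by rw [le_div_iff₀ hε0]; linarith)
        linarith [Real.log_two_gt_d9]
      have h5 : 0 ≤ (d : ℝ) ^ 5 := by positivity
      nlinarith
    · have h1 : (d : ℝ) ^ 2 / ε ≤ 2 * (d : ℝ) ^ 2 := by
        rw [div_le_iff₀ hε0]
        nlinarith [sq_nonneg (d : ℝ)]
      have h3 : 0 ≤ (d : ℝ) ^ 2 / ε * Real.log (1 / ε) := mul_nonneg hdε hlog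
      linarith
  have hm' : m ≤ 8004 * (d : ℝ) ^ 2 + 4 / ε := hm.trans (by nlinarith)
  have hB : (d : ℝ) ^ 2 + 4 * d + 7 ≤ 12 * (d : ℝ) ^ 2 := by nlinarith
  calc m * ((d : ℝ) ^ 2 + 4 * d + 7)
      ≤ (8004 * (d : ℝ) ^ 2 + 4 / ε) * (12 * (d : ℝ) ^ 2) :=
        mul_le_mul hm' hB (by positivity) (by positivity)
    _ = 96048 * (d : ℝ) ^ 4 + 48 * ((d : ℝ) ^ 2 / ε) := by ring
    _ ≤ _ := by
      have h3 : 0 ≤ (d : ℝ) ^ 2 / ε * Real.log (1 / ε) := mul_nonneg hdε hlog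
      linarith

end Main

end

theorem theorem1p1 :
    ∃ C : ℝ, 0 < C ∧
      ∀ (n d : ℕ) (L ε : ℝ), 1 ≤ d → 0 < L → 0 < ε →
        ∃ T : OracleTester (EuclideanSpace ℝ (Fin n)),
          (T.numQueries : ℝ) + (T.numSamples : ℝ) ≤
              C * ((d : ℝ) ^ 5 + (d : ℝ) ^ 2 / ε * Real.log (1 / ε)) ∧
          ∀ (D : Measure (EuclideanSpace ℝ (Fin n))) [IsProbabilityMeasure D]
            (f : EuclideanSpace ℝ (Fin n) → ℝ),
            (∃ M : ℝ, ∀ x ∈ Metric.ball (0 : EuclideanSpace ℝ (Fin n)) L, |f x| ≤ M) →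
              (f ∈ polynomialsOfDegreeLE n d → T.acceptProb D f = 1) ∧
              (IsFar D (polynomialsOfDegreeLE n d) ε f → 2 / 3 ≤ T.rejectProb D f) := by
  refine ⟨100000, by norm_num, fun n d L ε hd _ hε => ?_⟩
  obtain ⟨ρ, σ, R, hρ, hσ, hpair⟩ := exists_isCorrectionPair n d
  -- For `ε ≥ 1` no function is far, and zero rounds suffice. The budget is still nonnegative: `log
  -- (1 / ε) ≥ -ε` bounds the second term below by `-d ^ 2`.
  rcases le_or_gt 1 ε with hε1 | hε1
  · refine ⟨lineTester n d 0 ρ σ, ?_, fun D _ f _ => ⟨lineTester_acceptProb hd, fun hf => ?_⟩⟩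
    · rw [lineTester_cost, Nat.cast_zero, zero_mul]
      have hd1 : (1 : ℝ) ≤ d := by exact_mod_cast hd
      have h2 : (d : ℝ) ^ 2 ≤ (d : ℝ) ^ 5 := pow_le_pow_right₀ hd1 (by norm_num)
      have hlog : -ε ≤ Real.log (1 / ε) := by
        rw [one_div, Real.log_inv]
        linarith [Real.log_le_sub_one_of_pos hε]
      have h3 : (d : ℝ) ^ 2 / ε * -ε ≤ (d : ℝ) ^ 2 / ε * Real.log (1 / ε) :=
        mul_le_mul_of_nonneg_left hlog (by positivity)
      have h4 : (d : ℝ) ^ 2 / ε * -ε = -(d : ℝ) ^ 2 := by field_simp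
      exact mul_nonneg (by norm_num) (by linarith)
    · have h := hf (fun _ => 0) ⟨0, by simp, by simp⟩
      exact absurd (h.trans_le measureReal_le_one) (not_lt.2 hε1)
  -- The first bound is what self-correction tolerates; the second pays for the factor `2` lost in
  -- the sample test.
  · obtain ⟨η, hη⟩ : ∃ η : NNReal, (η : ℝ) = min (1 / (1000 * ((d : ℝ) + 1) ^ 2)) (ε / 2) :=
      ⟨⟨_, le_min (by positivity) (by positivity)⟩, rfl⟩
    have hη0 : (0 : ℝ) < η := by
      rw [hη]
      exact lt_min (by positivity) (by positivity)
    have hη1 : (η : ℝ) ≤ 1 / (1000 * ((d : ℝ) + 1) ^ 2) := hη ▸ min_le_left _ _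
    have hη2 : (η : ℝ) ≤ ε / 2 := hη ▸ min_le_right _ _
    set m := ⌈2 / (η : ℝ)⌉₊
    refine ⟨lineTester n d m ρ σ, ?_, fun D _ f _ => ⟨lineTester_acceptProb hd, fun hf =>
      two_thirds_le_lineTester_rejectProb hd hpair (by exact_mod_cast hη0) ?_ hη2 ?_ hf⟩⟩
    · rw [lineTester_cost]
      refine lineTester_budget hd hε hε1 ?_
      have h1 : (m : ℝ) ≤ 2 / (η : ℝ) + 1 := (Nat.ceil_lt_add_one (by positivity)).le
      have h2 : 1 / (η : ℝ) ≤ 1000 * ((d : ℝ) + 1) ^ 2 + 2 / ε := by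
        rw [hη]
        have hp : 0 ≤ 2 / ε := by positivity
        have hq : 0 ≤ 1000 * ((d : ℝ) + 1) ^ 2 := by positivity
        rcases min_choice (1 / (1000 * ((d : ℝ) + 1) ^ 2)) (ε / 2) with h | h <;> rw [h]
        · rw [one_div_one_div]
          linarith
        · rw [one_div_div]
          linarith
      have h3 : (1 : ℝ) ≤ ((d : ℝ) + 1) ^ 2 := one_le_pow₀ (by simp)
      have h4 : 2 / (η : ℝ) = 2 * (1 / η) := by ring
      have h5 : 4 / ε = 2 * (2 / ε) := by ring
      linarith
    · rw [← NNReal.coe_le_coe]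
      push_cast
      rw [le_div_iff₀ (by positivity)] at hη1
      linarith
    · rw [← NNReal.coe_le_coe]
      push_cast
      have := Nat.le_ceil (2 / (η : ℝ))
      rw [div_le_iff₀ hη0] at this
      linarith
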